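/- Let $n\ge 2$, let $d\xi$ be the spherical Lebesgue measure on the unit sphere $S^{n-1}\subset\mathbb R^n$, and let $\mathscr K_{(o)}^n$ be the set of compact convex sets $K\subset\mathbb R^n$ that contain the origin in their interior. For $K\in\mathscr K_{(o)}^n$ write $h_K(x)=\max\{x\cdot y: y\in K\}$ and $\rho_K(x)=\max\{t\ge 0: tx\in K\}$. For $\omega\subseteq S^{n-1}$ let $\boldsymbol\alpha_K^*(\omega)$ be the set of all $\xi\in S^{n-1}$ such that $K$ has an outer unit normal vector belonging to $\omega$ at the boundary point $\rho_K(\xi)\xi$, that is, $\rho_K(\xi)\,\xi\cdot u=h_K(u)$ for some $u\in\omega$; for $d\xi$-almost every $\xi\in S^{n-1}$ there is exactly one outer unit normal vector of $K$ at $\rho_K(\xi)\xi$, and it is denoted by $\alpha_K(\xi)$. Let $\mathcal C$ be the set of functions $G:S^{n-1}\times(0,\infty)\to\mathbb R$ such that $G$ and $G_t=\partial G/\partial t$ exist and are continuous on $S^{n-1}\times(0,\infty)$. Put $$\mathcal C_I=\{G\in\mathcal C: G_t>0\},\qquad \mathcal C_d=\{G\in\mathcal C: G_t<0\}.$$ Let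 $\mathscr G_I$ be the set of $G\in\mathcal C_I$ with $G>0$ and, for each $\xi\in S^{n-1}$, $\lim_{t\to0^+}G(\xi,t)=0$ and $\lim_{t\to\infty}G(\xi,t)=\infty$. Let $\mathscr G_d$ be the set of $G\in\mathcal C_d$ with $G>0$ and, for each $\xi\in S^{n-1}$, $\lim_{t\to0^+}G(\xi,t)=\infty$ and $\lim_{t\to\infty}G(\xi,t)=0$. For a triple $\Theta=(G,\Psi,\lambda)$ with $G\in\mathcal C$, $\Psi\in\mathcal C_I\cup\mathcal C_d$ and $\lambda$ a nonzero finite Borel measure on $S^{n-1}$ that is absolutely continuous with respect to $d\xi$, and for $K\in\mathscr K_{(o)}^n$, let $$\widetilde C_\Theta(K,\omega)=\int_{\boldsymbol\alpha_K^*(\omega)}\frac{\rho_K(\xi)\,G_t(\xi,\rho_K(\xi))}{h_K(\alpha_K(\xi))\,\Psi_t(\alpha_K(\xi),h_K(\alpha_K(\xi)))}\,d\lambda(\xi)\qquad(\omega\subseteq S^{n-1}\text{ Borel}).$$ A finite Borel measure $\mu$ on $S^{n-1}$ is said to be not concentrated on any closed hemisphere if $\int_{S^{n-1}}\max\{u\cdot\xi,0\}\,d\mu(\xi)>0$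 for every $u\in S^{n-1}$. Write $|\mu|=\mu(S^{n-1})$. **Theorem.** Let $\lambda$ be a nonzero finite Borel measure on $S^{n-1}$ that is absolutely continuous with respect to $d\xi$ and not concentrated on any closed hemisphere, and let $\mu$ be a nonzero finite Borel measure on $S^{n-1}$. Suppose that either (i) $\Psi\in\mathcal C_I$, $\lim_{t\to\infty}\Psi(\xi,t)=+\infty$ for each $\xi\in S^{n-1}$, and $G\in\mathscr G_d$; or (ii) $G\in\mathcal C_d$, $\lim_{t\to0^+}G(\xi,t)=+\infty$ for each $\xi\in S^{n-1}$, and $\Psi\in\mathscr G_I$. If $\mu$ is not concentrated on any closed hemisphere, then there exists $K\in\mathscr K_{(o)}^n$ such that $\widetilde C_\Theta(K,S^{n-1})\neq 0$ and $$\frac{\mu(\omega)}{|\mu|}=\frac{\widetilde C_\Theta(K,\omega)}{\widetilde C_\Theta(K,S^{n-1})}\qquad\text{for every Borel set }\omega\subseteq S^{n-1}.\tag{$*$}$$ Conversely, if in addition $\lambda(U)>0$ for every nonempty open set $U\subseteq S^{n-1}$, and there is $K\in\mathscr K_{(o)}^n$ with $\widetilde C_\Theta(K,S^{n-1})\neq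 0$ for which $(*)$ holds, then $\mu$ is not concentrated on any closed hemisphere. -/

import Mathlib

open Set Filter Topology MeasureTheory

noncomputable section

namespace MusielakOrlicz

/-- The Euclidean space `ℝⁿ`. -/
abbrev Space (n : ℕ) : Type := EuclideanSpace ℝ (Fin n)

/-- The unit sphere `S^{n-1}` of `ℝⁿ`. -/
abbrev Sphere (n : ℕ) : Type := Metric.sphere (0 : Space n) 1

/-- The spherical Lebesgue measure on `S^{n-1}`. -/
def sphericalMeasure (n : ℕ) : Measure (Sphere n) := (volume : Measure (Space n)).toSphere

/-- The class `𝒦_(o)^n` of convex bodies that contain the origin in their interiors. -/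
def bodiesAroundOrigin (n : ℕ) : Set (ConvexBody (Space n)) :=
  {K | (0 : Space n) ∈ interior (K : Set (Space n))}

/-- The support function `h_K(x) = max {x · y : y ∈ K}`. -/
def supportFunction {n : ℕ} (K : ConvexBody (Space n)) (x : Space n) : ℝ :=
  sSup ((fun y : Space n => inner ℝ x y) '' (K : Set (Space n)))

/-- The radial function `ρ_K(x) = max {t ≥ 0 : t x ∈ K}`. -/
def radialFunction {n : ℕ} (K : ConvexBody (Space n)) (x : Space n) : ℝ :=
  sSup {t : ℝ | 0 ≤ t ∧ t • x ∈ (K : Set (Space n))}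

/-- The radial map `r_K(ξ) = ρ_K(ξ) ξ`, from `S^{n-1}` onto `∂K`. -/
def radialMap {n : ℕ} (K : ConvexBody (Space n)) (ξ : Sphere n) : Space n :=
  radialFunction K (ξ : Space n) • (ξ : Space n)

/-- The (set valued) Gauss map: all outer unit normal vectors of `K` at `x ∈ ∂K`. -/
def gaussMap {n : ℕ} (K : ConvexBody (Space n)) (x : Space n) : Set (Sphere n) :=
  {u | inner ℝ x (u : Space n) = supportFunction K (u : Space n)}

/-- The inverse Gauss image of `ω`: all `x ∈ ∂K` with an outer unit normal vector in `ω`. -/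
def inverseGaussImage {n : ℕ} (K : ConvexBody (Space n)) (ω : Set (Sphere n)) : Set (Space n) :=
  {x | x ∈ frontier (K : Set (Space n)) ∧ ∃ u ∈ ω, u ∈ gaussMap K x}

/-- The (set valued) radial Gauss image of `ξ`: the outer unit normal vectors at `r_K(ξ)`. -/
def radialGaussImage {n : ℕ} (K : ConvexBody (Space n)) (ξ : Sphere n) : Set (Sphere n) :=
  gaussMap K (radialMap K ξ)

/-- The reverse radial Gauss image of `ω`: the set `r_K⁻¹(ν_K⁻¹(ω))`. -/
def reverseRadialGaussImage {n : ℕ} (K : ConvexBody (Space n)) (ω : Set (Sphere n)) :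
    Set (Sphere n) :=
  radialMap K ⁻¹' inverseGaussImage K ω

open Classical in
/-- The single valued radial Gauss map `α_K`: the unique outer unit normal vector at `r_K(ξ)`.
On the null set of those `ξ` for which the normal vector is not unique, the value is irrelevant
and is set to `ξ`. -/
def radialGaussMap {n : ℕ} (K : ConvexBody (Space n)) (ξ : Sphere n) : Sphere n :=
  if h : ∃ u, radialGaussImage K ξ = {u} then h.choose else ξ

/-- The class `𝒞`: `G` and its partial derivative `G_t` are continuous on `S^{n-1} × (0, ∞)`.
A function on `S^{n-1} × (0, ∞)` is represented by a function on `S^{n-1} × ℝ` of which only the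
values at positive `t` matter. -/
structure ClassC {n : ℕ} (G : Sphere n → ℝ → ℝ) : Prop where
  continuousOn : ContinuousOn (fun p : Sphere n × ℝ => G p.1 p.2) (univ ×ˢ Ioi 0)
  differentiableAt : ∀ ξ : Sphere n, ∀ t : ℝ, 0 < t → DifferentiableAt ℝ (G ξ) t
  continuousOn_deriv :
    ContinuousOn (fun p : Sphere n × ℝ => deriv (G p.1) p.2) (univ ×ˢ Ioi 0)

/-- The class `𝒞_I`: members of `𝒞` with `G_t > 0`. -/
structure ClassCI {n : ℕ} (G : Sphere n → ℝ → ℝ) : Prop extends ClassC G where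
  deriv_pos : ∀ ξ : Sphere n, ∀ t : ℝ, 0 < t → 0 < deriv (G ξ) t

/-- The class `𝒞_d`: members of `𝒞` with `G_t < 0`. -/
structure ClassCd {n : ℕ} (G : Sphere n → ℝ → ℝ) : Prop extends ClassC G where
  deriv_neg : ∀ ξ : Sphere n, ∀ t : ℝ, 0 < t → deriv (G ξ) t < 0

/-- The class `𝒢_I`. -/
structure ClassGI {n : ℕ} (G : Sphere n → ℝ → ℝ) : Prop extends ClassC G where
  pos : ∀ ξ : Sphere n, ∀ t : ℝ, 0 < t → 0 < G ξ t
  deriv_pos : ∀ ξ : Sphere n, ∀ t : ℝ, 0 < t → 0 < deriv (G ξ) t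
  tendsto_zero : ∀ ξ : Sphere n, Tendsto (G ξ) (𝓝[>] 0) (𝓝 0)
  tendsto_infty : ∀ ξ : Sphere n, Tendsto (G ξ) atTop atTop

/-- The class `𝒢_d`. -/
structure ClassGd {n : ℕ} (G : Sphere n → ℝ → ℝ) : Prop extends ClassC G where
  pos : ∀ ξ : Sphere n, ∀ t : ℝ, 0 < t → 0 < G ξ t
  deriv_neg : ∀ ξ : Sphere n, ∀ t : ℝ, 0 < t → deriv (G ξ) t < 0
  tendsto_zero : ∀ ξ : Sphere n, Tendsto (G ξ) (𝓝[>] 0) atTop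
  tendsto_infty : ∀ ξ : Sphere n, Tendsto (G ξ) atTop (𝓝 0)

/-- `μ` is not concentrated on any closed hemisphere: `∫ (u · ξ)₊ dμ(ξ) > 0` for every `u`. -/
def NotConcentratedOnHemisphere {n : ℕ} (μ : Measure (Sphere n)) : Prop :=
  ∀ u : Sphere n, 0 < ∫ ξ : Sphere n, max (inner ℝ (u : Space n) (ξ : Space n)) 0 ∂μ

/-- The density
`ρ_K(ξ) G_t(ξ, ρ_K(ξ)) / (h_K(α_K(ξ)) Ψ_t(α_K(ξ), h_K(α_K(ξ))))`. -/
def gaussImageDensity {n : ℕ} (G Ψ : Sphere n → ℝ → ℝ) (K : ConvexBody (Space n))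
    (ξ : Sphere n) : ℝ :=
  radialFunction K (ξ : Space n) * deriv (G ξ) (radialFunction K (ξ : Space n)) /
    (supportFunction K (radialGaussMap K ξ : Space n) *
      deriv (Ψ (radialGaussMap K ξ)) (supportFunction K (radialGaussMap K ξ : Space n)))

/-- The Musielak-Orlicz-Gauss image measure `C̃_Θ(K, ω)` of a Borel set `ω`, for the triple
`Θ = (G, Ψ, lam)`: the integral of the density over the reverse radial Gauss image of `ω`. -/
def gaussImageMeasure {n : ℕ} (G Ψ : Sphere n → ℝ → ℝ) (lam : Measure (Sphere n))
    (K : ConvexBody (Space n)) (ω : Set (Sphere n)) : ℝ :=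
  ∫ ξ in reverseRadialGaussImage K ω, gaussImageDensity G Ψ K ξ ∂lam

/-- `K` solves the normalized problem `μ / |μ| = C̃_Θ(K, ·) / C̃_Θ(K, S^{n-1})`, where the
denominator `C̃_Θ(K, S^{n-1})` is not zero. -/
def IsSolution {n : ℕ} (G Ψ : Sphere n → ℝ → ℝ) (lam μ : Measure (Sphere n))
    (K : ConvexBody (Space n)) : Prop :=
  gaussImageMeasure G Ψ lam K univ ≠ 0 ∧
    ∀ ω : Set (Sphere n), MeasurableSet ω →
      μ.real ω / μ.real univ =
        gaussImageMeasure G Ψ lam K ω / gaussImageMeasure G Ψ lam K univ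

end MusielakOrlicz

end

/-! A body is encoded by p = 1/h_K on the sphere. With g_p(x) = max_u p(u) u·x, the function g_p is
the gauge of K, so 1/ρ_K = g_p, and the unit normals of K at ρ_K(ξ)ξ are exactly the maximizers of
p(u) u·ξ. Put Γ(ξ,s) = G(ξ,1/s). In both cases Γ and Ψ increase to infinity in the second variable,
and at least one of them is positive.

Existence is variational: minimize ∫ Ψ(u,1/p(u)) dμ subject to ∫ Γ(ξ,g_p(ξ)) dλ ≤ c. Replacing a
positive p by 1/h of its Wulff shape {g_p ≤ 1} leaves the constraint unchanged and does not raise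
the objective, so every positive continuous p may compete. The hemisphere conditions on λ and μ
bound h_K from below and above (`exists_bounds_of_functionals_le`), and Arzelà–Ascoli then yields a
minimizer (`exists_minimizer`).

Under p + tφ the gauge has right derivative φ(α) α·ξ wherever the normal α is unique, which by
Rademacher is almost everywhere (`ae_radialGaussImage_eq`, `tendsto_slope_polarSupport`). At the
minimizer the first variation of the objective is nonnegative whenever that of the constraint is
negative, so the two linear functionals are proportional (`eq_mul_of_nonneg_of_neg`). A change of
test function turns this into ∫ ψ dμ = κ ∫ density · ψ(α_K) dλ, which determines μ.

For the converse, the density has a strict sign, and the directions close to u only have normals in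
the open hemisphere around u. That hemisphere therefore has nonzero image measure, hence positive
μ-mass. -/

noncomputable section

namespace MusielakOrlicz

/-! ### Gauge, support and radial functions; almost everywhere uniqueness of normals. -/

section Geometry

variable {n : ℕ}

/-- The support function of the convex hull of the radial graph of `p`. -/
def polarSupport (p : C(Sphere n, ℝ)) (x : Space n) : ℝ :=
  sSup ((fun u : Sphere n => p u * inner ℝ (u : Space n) x) '' univ)

lemma continuous_polarSupport_uncurry :
    Continuous (fun q : C(Sphere n, ℝ) × Space n => polarSupport q.1 q.2) := by
  refine IsCompact.continuous_sSup (f := fun (q : C(Sphere n, ℝ) × Space n) (u : Sphere n) =>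
    q.1 u * inner ℝ (u : Space n) q.2) isCompact_univ ?_
  have h1 : Continuous fun q : (C(Sphere n, ℝ) × Space n) × Sphere n => q.1.1 q.2 := by
    fun_prop
  exact h1.mul (by fun_prop)

lemma continuous_polarSupport (p : C(Sphere n, ℝ)) : Continuous (polarSupport p) :=
  continuous_polarSupport_uncurry.comp (Continuous.prodMk_right p)

lemma continuous_polarSupport_aux (p : C(Sphere n, ℝ)) (x : Space n) :
    Continuous fun u : Sphere n => p u * inner ℝ (u : Space n) x := by
  fun_prop

lemma le_polarSupport (p : C(Sphere n, ℝ)) (x : Space n) (u : Sphere n) :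
    p u * inner ℝ (u : Space n) x ≤ polarSupport p x :=
  le_csSup (isCompact_univ.image (continuous_polarSupport_aux p x)).bddAbove ⟨u, mem_univ u, rfl⟩

lemma exists_polarSupport_eq [Nonempty (Sphere n)] (p : C(Sphere n, ℝ)) (x : Space n) :
    ∃ u : Sphere n, polarSupport p x = p u * inner ℝ (u : Space n) x := by
  obtain ⟨u, -, hu⟩ := isCompact_univ.exists_sSup_image_eq univ_nonempty
    (continuous_polarSupport_aux p x).continuousOn
  exact ⟨u, hu⟩

lemma polarSupport_le_iff [Nonempty (Sphere n)] {p : C(Sphere n, ℝ)} {x : Space n} {c : ℝ} :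
    polarSupport p x ≤ c ↔ ∀ u : Sphere n, p u * inner ℝ (u : Space n) x ≤ c := by
  refine ⟨fun h u => (le_polarSupport p x u).trans h, fun h => ?_⟩
  obtain ⟨u, hu⟩ := exists_polarSupport_eq p x
  exact hu ▸ h u

lemma polarSupport_smul [Nonempty (Sphere n)] (p : C(Sphere n, ℝ)) {t : ℝ} (ht : 0 ≤ t)
    (x : Space n) : polarSupport p (t • x) = t * polarSupport p x := by
  have key : ∀ u : Sphere n, p u * inner ℝ (u : Space n) (t • x) =
      t * (p u * inner ℝ (u : Space n) x) := fun u => by rw [real_inner_smul_right]; ring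
  apply le_antisymm
  · refine polarSupport_le_iff.2 fun u => ?_
    rw [key]
    exact mul_le_mul_of_nonneg_left (le_polarSupport p x u) ht
  · obtain ⟨u, hu⟩ := exists_polarSupport_eq p x
    rw [hu, ← key]
    exact le_polarSupport _ _ _

lemma inner_self_sphere (ξ : Sphere n) : inner ℝ (ξ : Space n) (ξ : Space n) = (1 : ℝ) := by
  rw [real_inner_self_eq_norm_sq, norm_eq_of_mem_sphere]; norm_num

lemma inner_le_one_sphere (ξ η : Sphere n) : inner ℝ (ξ : Space n) (η : Space n) ≤ (1 : ℝ) := by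
  have := real_inner_le_norm (ξ : Space n) (η : Space n)
  simpa using this

lemma apply_le_polarSupport (p : C(Sphere n, ℝ)) (ξ : Sphere n) : p ξ ≤ polarSupport p ξ := by
  simpa [inner_self_sphere] using le_polarSupport p (ξ : Space n) ξ

lemma polarSupport_sphere_pos {p : C(Sphere n, ℝ)} (hp : ∀ u, 0 < p u)
    (ξ : Sphere n) : 0 < polarSupport p ξ :=
  (hp ξ).trans_le (apply_le_polarSupport p ξ)

lemma exists_eq_norm_smul_sphere {x : Space n}
    (hx : x ≠ 0) : ∃ ξ : Sphere n, x = ‖x‖ • (ξ : Space n) := by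
  have hx' : ‖x‖ ≠ 0 := norm_ne_zero_iff.2 hx
  refine ⟨⟨‖x‖⁻¹ • x, by simp [norm_smul, hx']⟩, ?_⟩
  simp [smul_smul, hx']

/-- A maximum of linear forms of norm at most ‖p‖. The Lipschitz bound is what makes Rademacher's
theorem applicable. -/
lemma lipschitz_polarSupport [Nonempty (Sphere n)] (p : C(Sphere n, ℝ)) :
    LipschitzWith ‖p‖₊ (polarSupport p) := by
  refine LipschitzWith.of_le_add_mul _ fun x y => ?_
  refine polarSupport_le_iff.2 fun u => ?_
  have h1 : p u * inner ℝ (u : Space n) x =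
      p u * inner ℝ (u : Space n) y + p u * inner ℝ (u : Space n) (x - y) := by
    rw [inner_sub_right]; ring
  have h2 : p u * inner ℝ (u : Space n) (x - y) ≤ ‖p‖ * dist x y := by
    calc p u * inner ℝ (u : Space n) (x - y) ≤ |p u| * |inner ℝ (u : Space n) (x - y)| := by
          rw [← abs_mul]; exact le_abs_self _
      _ ≤ ‖p‖ * dist x y := by
          gcongr
          · exact p.norm_coe_le_norm u
          · rw [dist_eq_norm]
            simpa using abs_real_inner_le_norm (u : Space n) (x - y)
  rw [h1, coe_nnnorm]
  exact add_le_add (le_polarSupport p y u) h2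

lemma isCompact_polarSupport_le_one [Nonempty (Sphere n)] {p : C(Sphere n, ℝ)}
    (hp : ∀ u, 0 < p u) : IsCompact {x : Space n | polarSupport p x ≤ 1} := by
  obtain ⟨u₀, -, hu₀⟩ := isCompact_univ.exists_isMinOn univ_nonempty p.continuous.continuousOn
  refine Metric.isCompact_of_isClosed_isBounded
    (isClosed_le (continuous_polarSupport p) continuous_const) ?_
  refine (Metric.isBounded_closedBall (x := (0 : Space n)) (r := 1 / p u₀)).subset fun x hx => ?_
  rw [mem_closedBall_zero_iff]
  by_cases h0 : x = 0
  · rw [h0, norm_zero]; exact (one_div_pos.2 (hp _)).le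
  obtain ⟨ξ, hξ⟩ := exists_eq_norm_smul_sphere h0
  have h1 : ‖x‖ * polarSupport p ξ ≤ 1 := by
    rw [← polarSupport_smul p (norm_nonneg x), ← hξ]; exact hx
  have h2 : p u₀ ≤ polarSupport p ξ := (hu₀ (mem_univ ξ)).trans (apply_le_polarSupport p ξ)
  rw [le_div_iff₀ (hp _)]
  exact (mul_le_mul_of_nonneg_left h2 (norm_nonneg x)).trans h1

/-- The Wulff shape of `1 / p`. -/
def wulffBody [Nonempty (Sphere n)] (p : C(Sphere n, ℝ)) (hp : ∀ u, 0 < p u) :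
    ConvexBody (Space n) where
  carrier := {x | polarSupport p x ≤ 1}
  convex' := by
    have : {x : Space n | polarSupport p x ≤ 1} =
        ⋂ u : Sphere n, {x | p u * inner ℝ (u : Space n) x ≤ 1} := by
      ext x; simp [polarSupport_le_iff]
    rw [this]
    refine convex_iInter fun u => ?_
    have : IsLinearMap ℝ fun x : Space n => p u * inner ℝ (u : Space n) x :=
      ⟨fun x y => by rw [inner_add_right, mul_add],
        fun c x => by rw [real_inner_smul_right, smul_eq_mul]; ring⟩
    exact convex_halfSpace_le this 1
  isCompact' := isCompact_polarSupport_le_one hp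
  nonempty' := ⟨0, by simp [polarSupport_le_iff]⟩

lemma mem_wulffBody [Nonempty (Sphere n)] {p : C(Sphere n, ℝ)} (hp : ∀ u, 0 < p u)
    {x : Space n} : x ∈ (wulffBody p hp : Set (Space n)) ↔ polarSupport p x ≤ 1 := Iff.rfl

lemma wulffBody_mem [Nonempty (Sphere n)] {p : C(Sphere n, ℝ)} (hp : ∀ u, 0 < p u) :
    wulffBody p hp ∈ bodiesAroundOrigin n := by
  have h0 : polarSupport p 0 < 1 := by
    obtain ⟨u, hu⟩ := exists_polarSupport_eq p (0 : Space n)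
    rw [hu, inner_zero_right, mul_zero]; exact one_pos
  refine mem_interior.2 ⟨{x | polarSupport p x < 1}, fun x hx => (mem_wulffBody hp).2 (le_of_lt hx),
    isOpen_lt (continuous_polarSupport p) continuous_const, h0⟩

lemma inner_le_supportFunction (K : ConvexBody (Space n)) (x : Space n) {y : Space n}
    (hy : y ∈ (K : Set (Space n))) : inner ℝ x y ≤ supportFunction K x :=
  le_csSup (K.isCompact.image (by fun_prop)).bddAbove ⟨y, hy, rfl⟩

lemma exists_supportFunction_eq (K : ConvexBody (Space n)) (x : Space n) :
    ∃ y ∈ (K : Set (Space n)), supportFunction K x = inner ℝ x y :=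
  K.isCompact.exists_sSup_image_eq K.nonempty (f := fun y => inner ℝ x y) (by fun_prop)

lemma continuous_supportFunction (K : ConvexBody (Space n)) :
    Continuous (supportFunction K) :=
  IsCompact.continuous_sSup (f := fun x y : Space n => inner ℝ x y) K.isCompact
    (by fun_prop)

lemma exists_closedBall_subset {K : ConvexBody (Space n)} (hK : K ∈ bodiesAroundOrigin n) :
    ∃ r > 0, Metric.closedBall (0 : Space n) r ⊆ (K : Set (Space n)) :=
  Metric.nhds_basis_closedBall.mem_iff.1 (mem_interior_iff_mem_nhds.1 hK)

lemma supportFunction_pos {K : ConvexBody (Space n)} (hK : K ∈ bodiesAroundOrigin n)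
    (u : Sphere n) : 0 < supportFunction K u := by
  obtain ⟨r, hr, h⟩ := exists_closedBall_subset hK
  have h1 : r • (u : Space n) ∈ (K : Set (Space n)) :=
    h (by simp [norm_smul, abs_of_pos hr])
  have := inner_le_supportFunction K (u : Space n) h1
  rw [real_inner_smul_right, inner_self_sphere, mul_one] at this
  exact hr.trans_le this

/-- The reciprocal of the support function, on the sphere. -/
def invSupport {K : ConvexBody (Space n)} (hK : K ∈ bodiesAroundOrigin n) : C(Sphere n, ℝ) where
  toFun u := (supportFunction K u)⁻¹
  continuous_toFun := ((continuous_supportFunction K).comp continuous_subtype_val).inv₀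
    fun u => (supportFunction_pos hK u).ne'

lemma invSupport_apply {K : ConvexBody (Space n)} (hK : K ∈ bodiesAroundOrigin n) (u : Sphere n) :
    invSupport hK u = (supportFunction K u)⁻¹ := rfl

lemma invSupport_pos {K : ConvexBody (Space n)} (hK : K ∈ bodiesAroundOrigin n) (u : Sphere n) :
    0 < invSupport hK u := inv_pos.2 (supportFunction_pos hK u)

/-- A closed convex set is the intersection of its supporting half-spaces (Hahn–Banach), so K is the
Wulff shape of its own support function. -/
lemma mem_iff_polarSupport_le [Nonempty (Sphere n)] {K : ConvexBody (Space n)}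
    (hK : K ∈ bodiesAroundOrigin n) {x : Space n} :
    x ∈ (K : Set (Space n)) ↔ polarSupport (invSupport hK) x ≤ 1 := by
  have key : ∀ u : Sphere n, invSupport hK u * inner ℝ (u : Space n) x ≤ 1 ↔
      inner ℝ (u : Space n) x ≤ supportFunction K u := fun u => by
    rw [invSupport_apply, inv_mul_le_iff₀ (supportFunction_pos hK u), mul_one]
  rw [polarSupport_le_iff]
  refine ⟨fun hx u => (key u).2 (inner_le_supportFunction K _ hx), fun h => ?_⟩
  by_contra hx
  obtain ⟨f, c, hf, hc⟩ := geometric_hahn_banach_closed_point K.convex K.isClosed hx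
  set v := (InnerProductSpace.toDual ℝ (Space n)).symm f with hv
  have hfv : ∀ y, f y = inner ℝ v y := fun y => by
    rw [hv, InnerProductSpace.toDual_symm_apply]
  have hv0 : v ≠ 0 := by
    intro h0
    obtain ⟨y, hy⟩ := K.nonempty
    have := (hf y hy).trans hc
    simp [hfv, h0] at this
  obtain ⟨u, hu⟩ := exists_eq_norm_smul_sphere hv0
  obtain ⟨y, hy, hy'⟩ := exists_supportFunction_eq K (u : Space n)
  have h1 := (key u).1 (h u)
  rw [hy'] at h1
  have h2 := (hf y hy).trans hc
  rw [hfv, hfv, hu, real_inner_smul_left, real_inner_smul_left] at h2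
  exact absurd (mul_le_mul_of_nonneg_left h1 (norm_nonneg v)) (not_le.2 h2)

/-- Stated for any p describing K, since it is used both for p = 1/h_K and for the possibly
different p that defines a Wulff shape. -/
lemma radialFunction_eq_of_mem_iff [Nonempty (Sphere n)] {K : ConvexBody (Space n)}
    {p : C(Sphere n, ℝ)} (hp : ∀ u, 0 < p u)
    (h : ∀ x, x ∈ (K : Set (Space n)) ↔ polarSupport p x ≤ 1) (ξ : Sphere n) :
    radialFunction K ξ = (polarSupport p ξ)⁻¹ := by
  have hpos := polarSupport_sphere_pos hp ξ
  have : {t : ℝ | 0 ≤ t ∧ t • (ξ : Space n) ∈ (K : Set (Space n))} =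
      Icc 0 (polarSupport p ξ)⁻¹ := by
    ext t
    simp only [mem_ofPred_eq, mem_Icc, h]
    refine and_congr_right fun ht => ?_
    rw [polarSupport_smul p ht, ← le_div_iff₀ hpos, one_div]
  rw [radialFunction, this, csSup_Icc (inv_nonneg.2 hpos.le)]

lemma radialFunction_eq [Nonempty (Sphere n)] {K : ConvexBody (Space n)}
    (hK : K ∈ bodiesAroundOrigin n) (ξ : Sphere n) :
    radialFunction K ξ = (polarSupport (invSupport hK) ξ)⁻¹ :=
  radialFunction_eq_of_mem_iff (invSupport_pos hK) (fun _ => mem_iff_polarSupport_le hK) ξ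

lemma radialFunction_pos [Nonempty (Sphere n)] {K : ConvexBody (Space n)}
    (hK : K ∈ bodiesAroundOrigin n) (ξ : Sphere n) : 0 < radialFunction K ξ := by
  rw [radialFunction_eq hK]
  exact inv_pos.2 (polarSupport_sphere_pos (invSupport_pos hK) ξ)

lemma continuous_radialFunction [Nonempty (Sphere n)] {K : ConvexBody (Space n)}
    (hK : K ∈ bodiesAroundOrigin n) : Continuous fun ξ : Sphere n => radialFunction K ξ := by
  simp_rw [radialFunction_eq hK]
  exact ((continuous_polarSupport _).comp continuous_subtype_val).inv₀
    fun ξ => (polarSupport_sphere_pos (invSupport_pos hK) ξ).ne'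

lemma radialMap_mem_frontier [Nonempty (Sphere n)] {K : ConvexBody (Space n)}
    (hK : K ∈ bodiesAroundOrigin n) (ξ : Sphere n) :
    radialMap K ξ ∈ frontier (K : Set (Space n)) := by
  have hg := polarSupport_sphere_pos (invSupport_pos hK) ξ
  have hρ := radialFunction_pos hK ξ
  have h1 : ∀ t : ℝ, 0 ≤ t → polarSupport (invSupport hK) (t • radialMap K ξ) = t := by
    intro t ht
    rw [radialMap, smul_smul, polarSupport_smul _ (mul_nonneg ht hρ.le), radialFunction_eq hK,
      mul_assoc, inv_mul_cancel₀ hg.ne', mul_one]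
  rw [K.isClosed.frontier_eq]
  refine ⟨(mem_iff_polarSupport_le hK).2 ?_, fun hint => ?_⟩
  · simpa using (h1 1 zero_le_one).le
  -- If the point were interior, t times it would stay in K for some t > 1, although the gauge there
  -- equals t.
  · have hc : Tendsto (fun t : ℝ => t • radialMap K ξ) (𝓝[>] 1) (𝓝 ((1 : ℝ) • radialMap K ξ)) :=
      ((continuous_id.smul continuous_const).tendsto 1).mono_left nhdsWithin_le_nhds
    rw [one_smul] at hc
    have h2 := hc.eventually (mem_interior_iff_mem_nhds.1 hint)
    obtain ⟨t, ht, ht1⟩ := (h2.and self_mem_nhdsWithin).exists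
    have ht1' : (1 : ℝ) < t := ht1
    have := (mem_iff_polarSupport_le hK).1 ht
    rw [h1 t (by linarith)] at this
    linarith

lemma mem_radialGaussImage_iff [Nonempty (Sphere n)] {K : ConvexBody (Space n)}
    (hK : K ∈ bodiesAroundOrigin n) (ξ u : Sphere n) :
    u ∈ radialGaussImage K ξ ↔
      polarSupport (invSupport hK) ξ = invSupport hK u * inner ℝ (u : Space n) (ξ : Space n) := by
  have hg := polarSupport_sphere_pos (invSupport_pos hK) ξ
  have hh := supportFunction_pos hK u
  rw [radialGaussImage, gaussMap, mem_ofPred_eq, radialMap, real_inner_smul_left,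
    radialFunction_eq hK, invSupport_apply, real_inner_comm, inv_mul_eq_iff_eq_mul₀ hg.ne',
    eq_inv_mul_iff_mul_eq₀ hh.ne', mul_comm (supportFunction K _)]
  exact eq_comm

lemma radialGaussImage_nonempty [Nonempty (Sphere n)] {K : ConvexBody (Space n)}
    (hK : K ∈ bodiesAroundOrigin n) (ξ : Sphere n) : (radialGaussImage K ξ).Nonempty := by
  obtain ⟨u, hu⟩ := exists_polarSupport_eq (invSupport hK) (ξ : Space n)
  exact ⟨u, (mem_radialGaussImage_iff hK ξ u).2 hu⟩

lemma mem_reverseRadialGaussImage_iff [Nonempty (Sphere n)] {K : ConvexBody (Space n)}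
    (hK : K ∈ bodiesAroundOrigin n) (ω : Set (Sphere n)) (ξ : Sphere n) :
    ξ ∈ reverseRadialGaussImage K ω ↔ ∃ u ∈ ω, u ∈ radialGaussImage K ξ := by
  simp only [reverseRadialGaussImage, inverseGaussImage, mem_preimage, mem_ofPred_eq,
    radialMap_mem_frontier hK ξ, true_and]
  rfl

lemma radialGaussImage_eq_singleton_radialGaussMap {K : ConvexBody (Space n)} {ξ : Sphere n}
    (h : ∃ u, radialGaussImage K ξ = {u}) : radialGaussImage K ξ = {radialGaussMap K ξ} := by
  rw [radialGaussMap, dif_pos h]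
  exact h.choose_spec

/-- The linear form of a maximizer lies below the gauge and touches it at x, so the difference has a
minimum there and its derivative vanishes. -/
lemma fderiv_polarSupport_eq {p : C(Sphere n, ℝ)} {x : Space n} {u : Sphere n}
    (hd : DifferentiableAt ℝ (polarSupport p) x)
    (hu : polarSupport p x = p u * inner ℝ (u : Space n) x) :
    fderiv ℝ (polarSupport p) x = p u • innerSL ℝ (u : Space n) := by
  have hmin : IsLocalMin
      (fun y => polarSupport p y - (p u • innerSL ℝ (u : Space n)) y) x := by
    refine Eventually.of_forall fun y => ?_
    have h1 := le_polarSupport p y u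
    simp only [smul_apply, innerSL_apply_apply, smul_eq_mul]
    rw [hu]
    linarith
  have h2 := hmin.hasFDerivAt_eq_zero
    (hd.hasFDerivAt.sub (p u • innerSL ℝ (u : Space n)).hasFDerivAt)
  exact sub_eq_zero.1 h2

/-- The normalized gradient of the gauge function. -/
def unitGradient (p : C(Sphere n, ℝ)) (x : Space n) : Space n :=
  ‖(InnerProductSpace.toDual ℝ (Space n)).symm (fderiv ℝ (polarSupport p) x)‖⁻¹ •
    (InnerProductSpace.toDual ℝ (Space n)).symm (fderiv ℝ (polarSupport p) x)

lemma measurable_unitGradient (p : C(Sphere n, ℝ)) : Measurable (unitGradient p) := by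
  have h : Measurable fun x => (InnerProductSpace.toDual ℝ (Space n)).symm
      (fderiv ℝ (polarSupport p) x) :=
    (InnerProductSpace.toDual ℝ (Space n)).symm.continuous.measurable.comp
      (measurable_fderiv ℝ (polarSupport p))
  exact h.norm.inv.smul h

lemma unitGradient_eq {p : C(Sphere n, ℝ)} (hp : ∀ u, 0 < p u) {x : Space n} {u : Sphere n}
    (hd : DifferentiableAt ℝ (polarSupport p) x)
    (hu : polarSupport p x = p u * inner ℝ (u : Space n) x) :
    unitGradient p x = u := by
  have h1 : (InnerProductSpace.toDual ℝ (Space n)).symm (fderiv ℝ (polarSupport p) x) =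
      p u • (u : Space n) := by
    rw [fderiv_polarSupport_eq hd hu, LinearIsometryEquiv.symm_apply_eq]
    ext y
    simp [InnerProductSpace.toDual_apply_apply]
  have h2 : ‖p u • (u : Space n)‖ = p u := by
    rw [norm_smul, norm_eq_of_mem_sphere, mul_one, Real.norm_of_nonneg (hp u).le]
  rw [unitGradient, h1, h2, smul_smul, inv_mul_cancel₀ (hp u).ne', one_smul]

lemma differentiableAt_polarSupport_smul [Nonempty (Sphere n)] (p : C(Sphere n, ℝ)) {x : Space n}
    {t : ℝ} (ht : 0 < t) (h : DifferentiableAt ℝ (polarSupport p) (t • x)) :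
    DifferentiableAt ℝ (polarSupport p) x := by
  have h1 : polarSupport p = fun y => t⁻¹ * polarSupport p (t • y) := by
    funext y
    rw [polarSupport_smul p ht.le, ← mul_assoc, inv_mul_cancel₀ ht.ne', one_mul]
  rw [h1]
  refine DifferentiableAt.const_mul ?_ _
  exact DifferentiableAt.comp x (f := fun y : Space n => t • y) (by simpa using h) (by fun_prop)

/-- Spherical measure is a multiple of the volume of the cone over a set. By homogeneity,
non-differentiability spreads along rays, so the cone over the bad set lies in the null set of
Rademacher's theorem. -/
lemma ae_differentiableAt_polarSupport [Nonempty (Sphere n)] (p : C(Sphere n, ℝ)) :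
    ∀ᵐ ξ : Sphere n ∂(sphericalMeasure n), DifferentiableAt ℝ (polarSupport p) (ξ : Space n) := by
  have hmeas : MeasurableSet {ξ : Sphere n | DifferentiableAt ℝ (polarSupport p) (ξ : Space n)} :=
    measurable_subtype_coe (measurableSet_of_differentiableAt ℝ (polarSupport p))
  have h0 : volume {x : Space n | ¬ DifferentiableAt ℝ (polarSupport p) x} = 0 :=
    (lipschitz_polarSupport p).ae_differentiableAt
  rw [ae_iff, sphericalMeasure]
  change (volume : Measure (Space n)).toSphere
    {ξ : Sphere n | DifferentiableAt ℝ (polarSupport p) (ξ : Space n)}ᶜ = 0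
  rw [Measure.toSphere_apply' _ hmeas.compl]
  refine mul_eq_zero_of_right _ (measure_mono_null ?_ h0)
  rintro _ ⟨t, ht, _, ⟨ξ, hξ, rfl⟩, rfl⟩ hd
  exact hξ (differentiableAt_polarSupport_smul p ht.1 hd)

section AlmostEverywhere

variable [Nonempty (Sphere n)] {K : ConvexBody (Space n)} {lam : Measure (Sphere n)}

/-- Where the gauge is differentiable, every normal equals the normalized gradient, hence there is
only one. -/
lemma ae_radialGaussImage_eq (hK : K ∈ bodiesAroundOrigin n) (hac : lam ≪ sphericalMeasure n) :
    ∀ᵐ ξ ∂lam, radialGaussImage K ξ = {radialGaussMap K ξ} ∧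
      unitGradient (invSupport hK) ξ = radialGaussMap K ξ := by
  filter_upwards [hac.ae_le (ae_differentiableAt_polarSupport (invSupport hK))] with ξ hξ
  have h1 : ∀ u ∈ radialGaussImage K ξ, unitGradient (invSupport hK) ξ = u := fun u hu =>
    unitGradient_eq (invSupport_pos hK) hξ ((mem_radialGaussImage_iff hK ξ u).1 hu)
  obtain ⟨v, hv⟩ := radialGaussImage_nonempty hK ξ
  have h2 : radialGaussImage K ξ = {radialGaussMap K ξ} :=
    radialGaussImage_eq_singleton_radialGaussMap
      ⟨v, eq_singleton_iff_unique_mem.2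
        ⟨hv, fun u hu => Subtype.ext ((h1 u hu).symm.trans (h1 v hv))⟩⟩
  exact ⟨h2, h1 _ (h2 ▸ mem_singleton _)⟩

/-- The normalized gradient is a measurable representative once the sphere is embedded in the
ambient space. -/
lemma aemeasurable_radialGaussMap (hK : K ∈ bodiesAroundOrigin n)
    (hac : lam ≪ sphericalMeasure n) : AEMeasurable (radialGaussMap K) lam := by
  have hemb : MeasurableEmbedding (Subtype.val : Sphere n → Space n) :=
    MeasurableEmbedding.subtype_coe (Metric.isClosed_sphere.measurableSet)
  rw [← hemb.aemeasurable_comp_iff]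
  refine ⟨fun ξ => unitGradient (invSupport hK) ξ,
    (measurable_unitGradient _).comp measurable_subtype_coe, ?_⟩
  filter_upwards [ae_radialGaussImage_eq hK hac] with ξ hξ
  exact hξ.2.symm

lemma reverseRadialGaussImage_ae_eq (hK : K ∈ bodiesAroundOrigin n)
    (hac : lam ≪ sphericalMeasure n) (ω : Set (Sphere n)) :
    reverseRadialGaussImage K ω =ᵐ[lam] radialGaussMap K ⁻¹' ω := by
  filter_upwards [ae_radialGaussImage_eq hK hac] with ξ hξ
  refine propext ((mem_reverseRadialGaussImage_iff hK ω ξ).trans ?_)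
  rw [hξ.1]
  simp only [mem_singleton_iff, exists_eq_right]
  rfl

end AlmostEverywhere

end Geometry

/-! ### Compactness, uniform bounds and differentiation under the integral. -/

section Analysis

variable {n : ℕ}

lemma abs_supportFunction_sub_le {K : ConvexBody (Space n)} {T : ℝ}
    (hT : ∀ y ∈ (K : Set (Space n)), ‖y‖ ≤ T) (u v : Space n) :
    |supportFunction K u - supportFunction K v| ≤ T * dist u v := by
  have key : ∀ u v : Space n, supportFunction K u - supportFunction K v ≤ T * dist u v := by
    intro u v
    obtain ⟨y, hy, h⟩ := exists_supportFunction_eq K u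
    have h1 := inner_le_supportFunction K v hy
    have h2 : inner ℝ u y - inner ℝ v y ≤ ‖u - v‖ * ‖y‖ := by
      rw [← inner_sub_left]; exact real_inner_le_norm _ _
    rw [h, dist_eq_norm]
    nlinarith [hT y hy, norm_nonneg (u - v)]
  rw [abs_le]
  have h1 := key v u
  rw [dist_comm] at h1
  exact ⟨by linarith, key u v⟩

lemma isCompact_setOf_bounded_lipschitz (a b : ℝ) {L : ℝ} (hL : 0 ≤ L) :
    IsCompact {p : C(Sphere n, ℝ) | (∀ u, p u ∈ Icc a b) ∧
      ∀ u v, |p u - p v| ≤ L * dist u v} := by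
  refine ArzelaAscoli.isCompact_of_equicontinuous _ ?_ ?_
  -- Compactness in the topology of pointwise convergence: the Lipschitz bound is a closed condition
  -- there, and it makes the functions in question automatically continuous.
  · have himg : ContinuousMap.toFun '' {p : C(Sphere n, ℝ) | (∀ u, p u ∈ Icc a b) ∧
        ∀ u v, |p u - p v| ≤ L * dist u v} =
        (Set.pi univ fun _ => Icc a b) ∩ {f | ∀ u v, |f u - f v| ≤ L * dist u v} := by
      ext f
      constructor
      · rintro ⟨p, hp, rfl⟩
        exact ⟨fun u _ => hp.1 u, hp.2⟩
      · rintro ⟨h1, h2⟩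
        have hf : LipschitzWith L.toNNReal f := LipschitzWith.of_dist_le_mul fun u v => by
          rw [Real.dist_eq, Real.coe_toNNReal L hL]; exact h2 u v
        exact ⟨⟨f, hf.continuous⟩, ⟨fun u => h1 u (mem_univ u), h2⟩, rfl⟩
    rw [himg]
    refine (isCompact_univ_pi fun _ => isCompact_Icc).inter_right ?_
    have : {f : Sphere n → ℝ | ∀ u v, |f u - f v| ≤ L * dist u v} =
        ⋂ u, ⋂ v, {f | |f u - f v| ≤ L * dist u v} := by
      ext f; simp
    rw [this]
    exact isClosed_iInter fun u => isClosed_iInter fun v =>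
      isClosed_le (by fun_prop) continuous_const
  · refine (LipschitzWith.uniformEquicontinuous _ L.toNNReal fun p => ?_).equicontinuous
    refine LipschitzWith.of_dist_le_mul fun u v => ?_
    rw [Real.dist_eq, Real.coe_toNNReal L hL]
    exact p.2.2 u v

lemma le_polarSupport_add_smul (p φ : C(Sphere n, ℝ)) {t : ℝ} {x : Space n} {v : Sphere n}
    (hv : polarSupport p x = p v * inner ℝ (v : Space n) x) :
    polarSupport p x + t * (φ v * inner ℝ (v : Space n) x) ≤ polarSupport (p + t • φ) x := by
  have h1 := le_polarSupport (p + t • φ) x v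
  have h2 : (p + t • φ) v * inner ℝ (v : Space n) x =
      p v * inner ℝ (v : Space n) x + t * (φ v * inner ℝ (v : Space n) x) := by
    simp only [ContinuousMap.add_apply, ContinuousMap.smul_apply, smul_eq_mul]; ring
  rw [h2] at h1
  rwa [hv]

lemma abs_mul_inner_le (φ : C(Sphere n, ℝ)) (u ξ : Sphere n) :
    |φ u * inner ℝ (u : Space n) (ξ : Space n)| ≤ ‖φ‖ := by
  rw [abs_mul, ← mul_one ‖φ‖]
  refine mul_le_mul (φ.norm_coe_le_norm u) ?_ (abs_nonneg _) (norm_nonneg _)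
  simpa using abs_real_inner_le_norm (u : Space n) (ξ : Space n)

lemma eventually_add_smul_mem {a b B : ℝ} (ha : 0 < a) {y₀ : Sphere n → ℝ}
    {y : ℝ → Sphere n → ℝ} (hab : ∀ ξ, y₀ ξ ∈ Icc a b)
    (hB : ∀ t > 0, ∀ ξ, |y t ξ - y₀ ξ| ≤ B * t) :
    ∀ᶠ t in 𝓝[>] (0 : ℝ), ∀ ξ, y t ξ ∈ Icc (a / 2) (b + a / 2) := by
  have h5 : Tendsto (fun t : ℝ => B * t) (𝓝[>] 0) (𝓝 0) := by
    have : Continuous fun t : ℝ => B * t := by fun_prop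
    simpa using (this.tendsto 0).mono_left nhdsWithin_le_nhds
  filter_upwards [h5.eventually (gt_mem_nhds (half_pos ha)), self_mem_nhdsWithin] with t h1 h2 ξ
  have h3 := abs_le.1 (hB t h2 ξ)
  have h4 := hab ξ
  constructor <;> linarith [h4.1, h4.2]

lemma ClassC.continuous_comp {H : Sphere n → ℝ → ℝ} (hH : ClassC H) {X : Type*}
    [TopologicalSpace X] {f : X → Sphere n} {q : X → ℝ} (hf : Continuous f) (hq : Continuous q)
    (hpos : ∀ x, 0 < q x) : Continuous fun x => H (f x) (q x) :=
  hH.continuousOn.comp_continuous (hf.prodMk hq) fun x => ⟨mem_univ _, hpos x⟩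

lemma ClassC.continuous_deriv_comp {H : Sphere n → ℝ → ℝ} (hH : ClassC H) {X : Type*}
    [TopologicalSpace X] {f : X → Sphere n} {q : X → ℝ} (hf : Continuous f) (hq : Continuous q)
    (hpos : ∀ x, 0 < q x) : Continuous fun x => deriv (H (f x)) (q x) :=
  hH.continuousOn_deriv.comp_continuous (hf.prodMk hq) fun x => ⟨mem_univ _, hpos x⟩

lemma integrable_of_continuous {ν : Measure (Sphere n)} [IsFiniteMeasure ν] {f : Sphere n → ℝ}
    (hf : Continuous f) : Integrable f ν :=
  hf.integrable_of_hasCompactSupport (HasCompactSupport.of_compactSpace f)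

lemma ClassC.integrable {H : Sphere n → ℝ → ℝ} (hH : ClassC H) (ν : Measure (Sphere n))
    [IsFiniteMeasure ν] {q : Sphere n → ℝ} (hq : Continuous q) (hpos : ∀ x, 0 < q x) :
    Integrable (fun ξ => H ξ (q ξ)) ν :=
  integrable_of_continuous (hH.continuous_comp continuous_id hq hpos)

lemma ClassC.exists_bound {H : Sphere n → ℝ → ℝ} (hH : ClassC H) {a : ℝ} (b : ℝ) (ha : 0 < a) :
    ∃ L : ℝ, 0 ≤ L ∧ ∀ ξ, ∀ t ∈ Icc a b, |H ξ t| ≤ L ∧ |deriv (H ξ) t| ≤ L := by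
  have hsub : (univ : Set (Sphere n)) ×ˢ Icc a b ⊆ univ ×ˢ Ioi 0 :=
    prod_mono subset_rfl fun t ht => ha.trans_le ht.1
  have hc : IsCompact ((univ : Set (Sphere n)) ×ˢ Icc a b) := isCompact_univ.prod isCompact_Icc
  obtain ⟨L₁, h₁⟩ := hc.exists_bound_of_continuousOn (hH.continuousOn.mono hsub)
  obtain ⟨L₂, h₂⟩ := hc.exists_bound_of_continuousOn (hH.continuousOn_deriv.mono hsub)
  refine ⟨max (max L₁ L₂) 0, le_max_right _ _, fun ξ t ht => ⟨?_, ?_⟩⟩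
  · exact (h₁ (ξ, t) ⟨mem_univ _, ht⟩).trans ((le_max_left _ _).trans (le_max_left _ _))
  · exact (h₂ (ξ, t) ⟨mem_univ _, ht⟩).trans ((le_max_right _ _).trans (le_max_left _ _))

lemma ClassC.deriv_inv {H : Sphere n → ℝ → ℝ} (hH : ClassC H) (ξ : Sphere n) {t : ℝ}
    (ht : 0 < t) : HasDerivAt (fun s => H ξ s⁻¹) (-(deriv (H ξ) t⁻¹ * (t ^ 2)⁻¹)) t := by
  have h1 := (hH.differentiableAt ξ t⁻¹ (inv_pos.2 ht)).hasDerivAt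
  have h2 : HasDerivAt (fun s => H ξ s⁻¹) (deriv (H ξ) t⁻¹ * -(t ^ 2)⁻¹) t :=
    HasDerivAt.comp t h1 (hasDerivAt_inv ht.ne')
  rwa [mul_neg] at h2

lemma ClassC.inv {H : Sphere n → ℝ → ℝ} (hH : ClassC H) : ClassC fun ξ s => H ξ s⁻¹ where
  continuousOn := by
    refine hH.continuousOn.comp (f := fun p : Sphere n × ℝ => (p.1, p.2⁻¹)) ?_
      fun p hp => ⟨mem_univ _, inv_pos.2 (mem_Ioi.1 hp.2)⟩
    exact continuousOn_fst.prodMk (continuousOn_snd.inv₀ fun p hp => (mem_Ioi.1 hp.2).ne')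
  differentiableAt ξ t ht := (hH.deriv_inv ξ ht).differentiableAt
  continuousOn_deriv := by
    have h1 : ContinuousOn (fun p : Sphere n × ℝ => -(deriv (H p.1) p.2⁻¹ * (p.2 ^ 2)⁻¹))
        (univ ×ˢ Ioi 0) := by
      refine (ContinuousOn.mul ?_ ?_).neg
      · refine hH.continuousOn_deriv.comp (f := fun p : Sphere n × ℝ => (p.1, p.2⁻¹)) ?_
          fun p hp => ⟨mem_univ _, inv_pos.2 (mem_Ioi.1 hp.2)⟩
        exact continuousOn_fst.prodMk (continuousOn_snd.inv₀ fun p hp => (mem_Ioi.1 hp.2).ne')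
      · exact (continuousOn_snd.pow 2).inv₀ fun p hp => (pow_pos (mem_Ioi.1 hp.2) 2).ne'
    exact h1.congr fun p hp => (hH.deriv_inv p.1 (mem_Ioi.1 hp.2)).deriv

lemma ClassCI.inv {H : Sphere n → ℝ → ℝ} (hH : ClassCI H) : ClassCd fun ξ s => H ξ s⁻¹ where
  toClassC := hH.toClassC.inv
  deriv_neg ξ t ht := by
    rw [(hH.toClassC.deriv_inv ξ ht).deriv, neg_lt_zero]
    exact mul_pos (hH.deriv_pos ξ _ (inv_pos.2 ht)) (inv_pos.2 (pow_pos ht 2))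

lemma ClassCd.inv {H : Sphere n → ℝ → ℝ} (hH : ClassCd H) : ClassCI fun ξ s => H ξ s⁻¹ where
  toClassC := hH.toClassC.inv
  deriv_pos ξ t ht := by
    rw [(hH.toClassC.deriv_inv ξ ht).deriv, neg_pos]
    exact mul_neg_of_neg_of_pos (hH.deriv_neg ξ _ (inv_pos.2 ht)) (inv_pos.2 (pow_pos ht 2))

lemma ClassCI.monotoneOn {H : Sphere n → ℝ → ℝ} (hH : ClassCI H) (ξ : Sphere n) :
    MonotoneOn (H ξ) (Ioi 0) := by
  refine monotoneOn_of_deriv_nonneg (convex_Ioi 0)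
    (fun t ht => (hH.differentiableAt ξ t ht).continuousAt.continuousWithinAt) ?_ ?_
  · rw [interior_Ioi]
    exact fun t ht => (hH.differentiableAt ξ t ht).differentiableWithinAt
  · rw [interior_Ioi]
    exact fun t ht => (hH.deriv_pos ξ t ht).le

/-- A Dini argument: the bound at one T holds on a neighbourhood of ξ by continuity, persists for
larger t by monotonicity, and finitely many neighbourhoods suffice. -/
lemma ClassCI.exists_forall_le {H : Sphere n → ℝ → ℝ} (hH : ClassCI H)
    (hlim : ∀ ξ, Tendsto (H ξ) atTop atTop) (C : ℝ) :
    ∃ T > 0, ∀ ξ, ∀ t ≥ T, C ≤ H ξ t := by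
  have key : ∃ T > 0, ∀ ξ ∈ (univ : Set (Sphere n)), ∀ t ≥ T, C ≤ H ξ t := by
    refine isCompact_univ.induction_on (p := fun s => ∃ T > 0, ∀ ξ ∈ s, ∀ t ≥ T, C ≤ H ξ t)
      ⟨1, one_pos, by simp⟩ ?_ ?_ ?_
    · rintro s s' hss ⟨T, hT, h⟩
      exact ⟨T, hT, fun ξ hξ => h ξ (hss hξ)⟩
    · rintro s s' ⟨T, hT, h⟩ ⟨T', hT', h'⟩
      refine ⟨max T T', lt_max_of_lt_left hT, ?_⟩
      rintro ξ (hξ | hξ) t ht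
      · exact h ξ hξ t ((le_max_left _ _).trans ht)
      · exact h' ξ hξ t ((le_max_right _ _).trans ht)
    · intro ξ _
      obtain ⟨T, hT, hT0⟩ := (((hlim ξ).eventually_gt_atTop C).and (eventually_gt_atTop 0)).exists
      have hc : Continuous fun η => H η T :=
        hH.toClassC.continuous_comp continuous_id continuous_const fun _ => hT0
      refine ⟨_, mem_nhdsWithin_of_mem_nhds (hc.continuousAt.eventually (lt_mem_nhds hT)), T, hT0,
        fun η hη t ht => ?_⟩
      exact (le_of_lt hη).trans (hH.monotoneOn η hT0 (hT0.trans_le ht) ht)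
  obtain ⟨T, hT, h⟩ := key
  exact ⟨T, hT, fun ξ => h ξ (mem_univ ξ)⟩

/-- Compactness of the sphere makes the hemisphere condition quantitative: each cap has mass bounded
below, uniformly in its centre. -/
lemma NotConcentratedOnHemisphere.exists_le [Nonempty (Sphere n)] {ν : Measure (Sphere n)}
    [IsFiniteMeasure ν] (hν : NotConcentratedOnHemisphere ν) :
    ∃ ε > 0, ∀ v : Sphere n, ε ≤ ν.real {ξ : Sphere n | ε ≤ inner ℝ (v : Space n) (ξ : Space n)} := by
  have hcont : Continuous fun v : Sphere n =>
      ∫ ξ : Sphere n, max (inner ℝ (v : Space n) (ξ : Space n)) 0 ∂ν := by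
    refine continuous_of_dominated (bound := fun _ => 1) ?_ ?_ (integrable_const _) ?_
    · exact fun v => (by fun_prop : Continuous fun ξ : Sphere n =>
        max (inner ℝ (v : Space n) (ξ : Space n)) 0).aestronglyMeasurable
    · refine fun v => Eventually.of_forall fun ξ => ?_
      rw [Real.norm_of_nonneg (le_max_right _ _)]
      exact max_le (inner_le_one_sphere v ξ) zero_le_one
    · exact Eventually.of_forall fun ξ => by fun_prop
  obtain ⟨v₀, -, hv₀⟩ := isCompact_univ.exists_isMinOn univ_nonempty hcont.continuousOn
  set m := ∫ ξ : Sphere n, max (inner ℝ (v₀ : Space n) (ξ : Space n)) 0 ∂ν with hm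
  have hm0 : 0 < m := hν v₀
  set M := ν.real univ with hM
  have hM0 : 0 ≤ M := measureReal_nonneg
  -- Chosen so that m - ε M = ε: off the cap the integrand is at most ε, on it at most 1, whence m ≤
  -- ν(A) + ε M.
  have hε : 0 < m / (M + 1) := by positivity
  refine ⟨m / (M + 1), hε, fun v => ?_⟩
  set ε := m / (M + 1) with hεdef
  set A := {ξ : Sphere n | ε ≤ inner ℝ (v : Space n) (ξ : Space n)} with hA
  have hAm : MeasurableSet A :=
    (isClosed_le continuous_const (by fun_prop)).measurableSet
  have h1 : m ≤ ∫ ξ : Sphere n, max (inner ℝ (v : Space n) (ξ : Space n)) 0 ∂ν := hv₀ (mem_univ v)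
  have h2 : ∫ ξ : Sphere n, max (inner ℝ (v : Space n) (ξ : Space n)) 0 ∂ν ≤
      ∫ ξ : Sphere n, (A.indicator (fun _ => 1) ξ + ε) ∂ν := by
    refine integral_mono (integrable_of_continuous (by fun_prop))
      (((integrable_const _).indicator hAm).add (integrable_const _)) fun ξ => ?_
    by_cases hξ : ξ ∈ A
    · simp only [indicator_of_mem hξ]
      exact (max_le (inner_le_one_sphere v ξ) zero_le_one).trans (by linarith)
    · simp only [indicator_of_notMem hξ, zero_add]
      exact max_le (not_le.1 hξ).le hε.le
  rw [integral_add ((integrable_const _).indicator hAm) (integrable_const _),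
    integral_indicator_const _ hAm, integral_const] at h2
  simp only [smul_eq_mul, mul_one] at h2
  have h3 : ε * (M + 1) = m := div_mul_cancel₀ _ (by positivity)
  nlinarith [h1, h2, h3]

/-- A priori bound: if the integral of `H (ξ, q ξ)` is bounded then `q` cannot dominate a large
multiple of a linear functional. -/
lemma ClassCI.exists_apriori_bound [Nonempty (Sphere n)] {H : Sphere n → ℝ → ℝ} (hH : ClassCI H)
    (hlim : ∀ ξ, Tendsto (H ξ) atTop atTop) {ν : Measure (Sphere n)} [IsFiniteMeasure ν]
    (hν : NotConcentratedOnHemisphere ν) (B M : ℝ) :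
    ∃ T > 0, ∀ (τ : ℝ) (v : Sphere n) (q : Sphere n → ℝ), Continuous q → (∀ ξ, 0 < q ξ) →
      (∀ ξ : Sphere n, τ * inner ℝ (v : Space n) (ξ : Space n) ≤ q ξ) →
      (∀ ξ, -B ≤ H ξ (q ξ)) → ∫ ξ, H ξ (q ξ) ∂ν ≤ M → τ ≤ T := by
  obtain ⟨ε, hε, hνε⟩ := hν.exists_le
  set D := M + B * ν.real univ with hD
  -- If τ exceeded T / ε, then q ≥ T on a cap of mass at least ε, where H + B is at least (|D| + 1)
  -- / ε. The integral of H + B would be at least |D| + 1, but it is at most D.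
  obtain ⟨T, hT, hTC⟩ := hH.exists_forall_le hlim ((|D| + 1) / ε - B)
  refine ⟨T / ε, div_pos hT hε, fun τ v q hq hq0 hqτ hB hM => ?_⟩
  by_contra hτ
  rw [not_le, div_lt_iff₀ hε] at hτ
  have hτ0 : 0 < τ := pos_of_mul_pos_left (hT.trans hτ) hε.le
  set A := {ξ : Sphere n | ε ≤ inner ℝ (v : Space n) (ξ : Space n)} with hA
  have hAm : MeasurableSet A := (isClosed_le continuous_const (by fun_prop)).measurableSet
  have hint := hH.toClassC.integrable ν hq hq0
  have h2 : ∫ ξ : Sphere n, A.indicator (fun _ => (|D| + 1) / ε) ξ ∂ν ≤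
      ∫ ξ : Sphere n, (H ξ (q ξ) + B) ∂ν := by
    refine integral_mono ((integrable_const _).indicator hAm) (hint.add (integrable_const _))
      fun ξ => ?_
    by_cases hξ : ξ ∈ A
    · simp only [indicator_of_mem hξ]
      have h3 : T ≤ q ξ := hτ.le.trans
        ((mul_le_mul_of_nonneg_left hξ hτ0.le).trans (hqτ ξ))
      linarith [hTC ξ _ h3]
    · simp only [indicator_of_notMem hξ]
      linarith [hB ξ]
  rw [integral_add hint (integrable_const _), integral_indicator_const _ hAm, integral_const] at h2
  simp only [smul_eq_mul] at h2
  have h4 : ε * ((|D| + 1) / ε) ≤ ν.real A * ((|D| + 1) / ε) :=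
    mul_le_mul_of_nonneg_right (hνε v) (by positivity)
  rw [mul_div_cancel₀ _ hε.ne'] at h4
  have := le_abs_self D
  nlinarith

lemma ClassC.continuousOn_integral {H : Sphere n → ℝ → ℝ} (hH : ClassC H) (ν : Measure (Sphere n))
    [IsFiniteMeasure ν] {X : Type*} [TopologicalSpace X] [FirstCountableTopology X]
    {y : X → Sphere n → ℝ} (hy : Continuous (Function.uncurry y)) {A : Set X} {a b : ℝ}
    (ha : 0 < a) (hA : ∀ x ∈ A, ∀ ξ, y x ξ ∈ Icc a b) :
    ContinuousOn (fun x => ∫ ξ, H ξ (y x ξ) ∂ν) A := by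
  obtain ⟨L, -, hL⟩ := hH.exists_bound b ha
  refine continuousOn_of_dominated (bound := fun _ => L) ?_ ?_ (integrable_const _) ?_
  · exact fun x hx => (hH.integrable ν (hy.comp (Continuous.prodMk_right x))
      fun ξ => ha.trans_le (hA x hx ξ).1).aestronglyMeasurable
  · exact fun x hx => Eventually.of_forall fun ξ => (hL ξ _ (hA x hx ξ)).1
  · refine Eventually.of_forall fun ξ => ?_
    refine hH.continuousOn.comp (f := fun x => (ξ, y x ξ)) ?_
      fun x hx => ⟨mem_univ _, ha.trans_le (hA x hx ξ).1⟩
    exact (continuous_const.prodMk (hy.comp (Continuous.prodMk_left ξ))).continuousOn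

lemma ClassC.abs_sub_le {H : Sphere n → ℝ → ℝ} (hH : ClassC H) {a b L : ℝ} (ha : 0 < a)
    (hL : ∀ ξ, ∀ t ∈ Icc a b, |H ξ t| ≤ L ∧ |deriv (H ξ) t| ≤ L) (ξ : Sphere n) {s t : ℝ}
    (hs : s ∈ Icc a b) (ht : t ∈ Icc a b) : |H ξ t - H ξ s| ≤ L * |t - s| := by
  have := (convex_Icc a b).norm_image_sub_le_of_norm_deriv_le (f := H ξ) (C := L)
    (fun r hr => hH.differentiableAt ξ r (ha.trans_le hr.1)) (fun r hr => (hL ξ r hr).2) hs ht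
  simpa using this

/-- Dominated convergence: the mean value inequality bounds the quotients by L * B, and the chain
rule gives the pointwise limit. -/
lemma ClassC.tendsto_integral_slope {H : Sphere n → ℝ → ℝ} (hH : ClassC H)
    (ν : Measure (Sphere n)) [IsFiniteMeasure ν] {y₀ w : Sphere n → ℝ} {y : ℝ → Sphere n → ℝ}
    (hy₀ : Continuous y₀) (hy : ∀ t, Continuous (y t)) {a b B : ℝ} (ha : 0 < a)
    (hy₀ab : ∀ ξ, y₀ ξ ∈ Icc a b) (hyab : ∀ᶠ t in 𝓝[>] (0 : ℝ), ∀ ξ, y t ξ ∈ Icc a b)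
    (hB : ∀ᶠ t in 𝓝[>] (0 : ℝ), ∀ ξ, |y t ξ - y₀ ξ| ≤ B * t)
    (hw : ∀ᵐ ξ ∂ν, Tendsto (fun t => t⁻¹ * (y t ξ - y₀ ξ)) (𝓝[>] 0) (𝓝 (w ξ))) :
    Tendsto (fun t => t⁻¹ * (∫ ξ, H ξ (y t ξ) ∂ν - ∫ ξ, H ξ (y₀ ξ) ∂ν)) (𝓝[>] 0)
      (𝓝 (∫ ξ, deriv (H ξ) (y₀ ξ) * w ξ ∂ν)) := by
  obtain ⟨L, hL0, hL⟩ := hH.exists_bound b ha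
  have hpos₀ : ∀ ξ, 0 < y₀ ξ := fun ξ => ha.trans_le (hy₀ab ξ).1
  have hi₀ := hH.integrable ν hy₀ hpos₀
  have hi : ∀ᶠ t in 𝓝[>] (0 : ℝ), Integrable (fun ξ => H ξ (y t ξ)) ν :=
    hyab.mono fun t ht => hH.integrable ν (hy t) fun ξ => ha.trans_le (ht ξ).1
  have hmain : Tendsto (fun t => ∫ ξ, t⁻¹ * (H ξ (y t ξ) - H ξ (y₀ ξ)) ∂ν) (𝓝[>] 0)
      (𝓝 (∫ ξ, deriv (H ξ) (y₀ ξ) * w ξ ∂ν)) := by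
    refine tendsto_integral_filter_of_dominated_convergence (fun _ => L * B)
      (hi.mono fun t ht => ((ht.sub hi₀).const_mul _).aestronglyMeasurable) ?_
      (integrable_const _) ?_
    · filter_upwards [hyab, hB, self_mem_nhdsWithin] with t h1 h2 h3
      refine Eventually.of_forall fun ξ => ?_
      have h3' : 0 < t := h3
      rw [Real.norm_eq_abs, abs_mul, abs_of_pos (inv_pos.2 h3'), inv_mul_le_iff₀ h3']
      calc |H ξ (y t ξ) - H ξ (y₀ ξ)| ≤ L * |y t ξ - y₀ ξ| :=
            hH.abs_sub_le ha hL ξ (hy₀ab ξ) (h1 ξ)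
        _ ≤ L * (B * t) := mul_le_mul_of_nonneg_left (h2 ξ) hL0
        _ = t * (L * B) := by ring
    · filter_upwards [hw] with ξ hξ
      have hd := (hH.differentiableAt ξ (y₀ ξ) (hpos₀ ξ)).hasDerivAt
      -- The family `y` need not take the value `y₀` at t = 0, so this value is patched in to apply
      -- the chain rule.
      set Y : ℝ → ℝ := fun t => if t = 0 then y₀ ξ else y t ξ with hY
      have hY0 : Y 0 = y₀ ξ := if_pos rfl
      have hYt : ∀ t ∈ Ioi (0 : ℝ), Y t = y t ξ := fun t ht => if_neg (ne_of_gt ht)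
      have hYd : HasDerivWithinAt Y (w ξ) (Ioi 0) 0 := by
        rw [hasDerivWithinAt_iff_tendsto_slope' (by simp)]
        refine hξ.congr' ?_
        filter_upwards [self_mem_nhdsWithin] with t ht
        rw [slope_def_field, hY0, hYt t ht, sub_zero, div_eq_inv_mul]
      have hcomp : HasDerivWithinAt (H ξ ∘ Y) (deriv (H ξ) (y₀ ξ) * w ξ) (Ioi 0) 0 := by
        refine HasDerivAt.comp_hasDerivWithinAt 0 ?_ hYd
        rw [hY0]; exact hd
      rw [hasDerivWithinAt_iff_tendsto_slope' (by simp)] at hcomp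
      refine hcomp.congr' ?_
      filter_upwards [self_mem_nhdsWithin] with t ht
      rw [slope_def_field, Function.comp_apply, Function.comp_apply, hY0, hYt t ht, sub_zero,
        div_eq_inv_mul]
  refine hmain.congr' ?_
  filter_upwards [hi] with t ht
  rw [integral_const_mul, integral_sub ht hi₀]

end Analysis

/-! ### The constrained minimization problem and existence of a minimizer. -/

section Minimization

variable {n : ℕ} [Nonempty (Sphere n)]

/-- Both sides are the gauge of the same Wulff shape, although q itself may be smaller than the
reciprocal of its support function. -/
lemma polarSupport_invSupport_wulffBody {q : C(Sphere n, ℝ)} (hq : ∀ u, 0 < q u) (ξ : Sphere n) :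
    polarSupport (invSupport (wulffBody_mem hq)) ξ = polarSupport q ξ := by
  have h1 := radialFunction_eq (wulffBody_mem hq) ξ
  rw [radialFunction_eq_of_mem_iff hq (fun x => mem_wulffBody hq) ξ] at h1
  exact (inv_injective h1).symm

lemma le_invSupport_wulffBody {q : C(Sphere n, ℝ)} (hq : ∀ u, 0 < q u) (u : Sphere n) :
    q u ≤ invSupport (wulffBody_mem hq) u := by
  obtain ⟨y, hy, h⟩ := exists_supportFunction_eq (wulffBody q hq) (u : Space n)
  have h1 := (le_polarSupport q y u).trans ((mem_wulffBody hq).1 hy)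
  rw [invSupport_apply, ← one_div, le_div_iff₀ (supportFunction_pos (wulffBody_mem hq) u), h]
  exact h1

lemma norm_le_of_mem {K : ConvexBody (Space n)} (hK : K ∈ bodiesAroundOrigin n) {T : ℝ}
    (hT : ∀ ξ : Sphere n, radialFunction K ξ ≤ T) {y : Space n} (hy : y ∈ (K : Set (Space n))) :
    ‖y‖ ≤ T := by
  by_cases h0 : y = 0
  · rw [h0, norm_zero]
    exact (radialFunction_pos hK (Classical.arbitrary _)).le.trans (hT _)
  obtain ⟨ξ, hξ⟩ := exists_eq_norm_smul_sphere h0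
  have h1 := (mem_iff_polarSupport_le hK).1 hy
  rw [hξ, polarSupport_smul _ (norm_nonneg y),
    ← le_div_iff₀ (polarSupport_sphere_pos (invSupport_pos hK) ξ), one_div,
    ← radialFunction_eq hK] at h1
  exact h1.trans (hT ξ)

lemma supportFunction_le_of_radialFunction_le {K : ConvexBody (Space n)}
    (hK : K ∈ bodiesAroundOrigin n) {T : ℝ} (hT : ∀ ξ : Sphere n, radialFunction K ξ ≤ T)
    (u : Sphere n) : supportFunction K u ≤ T := by
  obtain ⟨y, hy, h⟩ := exists_supportFunction_eq K (u : Space n)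
  rw [h]
  refine (real_inner_le_norm _ _).trans ?_
  rw [norm_eq_of_mem_sphere, one_mul]
  exact norm_le_of_mem hK hT hy

lemma radialFunction_mul_inner_le {K : ConvexBody (Space n)} (hK : K ∈ bodiesAroundOrigin n)
    (v u : Sphere n) :
    radialFunction K v * inner ℝ (v : Space n) (u : Space n) ≤ supportFunction K u := by
  have h1 : radialMap K v ∈ (K : Set (Space n)) :=
    K.isClosed.frontier_subset (radialMap_mem_frontier hK v)
  have := inner_le_supportFunction K (u : Space n) h1
  rwa [radialMap, real_inner_smul_right, real_inner_comm] at this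

lemma radialFunction_le_of_supportFunction_le {K : ConvexBody (Space n)}
    (hK : K ∈ bodiesAroundOrigin n) {T : ℝ} (hT : ∀ u : Sphere n, supportFunction K u ≤ T)
    (ξ : Sphere n) : radialFunction K ξ ≤ T := by
  have := (radialFunction_mul_inner_le hK ξ ξ).trans (hT ξ)
  rwa [inner_self_sphere, mul_one] at this

/-- The functional on the reciprocals of the support functions which is constrained. -/
def dualFunctional (Γ : Sphere n → ℝ → ℝ) (lam : Measure (Sphere n)) (p : C(Sphere n, ℝ)) : ℝ :=
  ∫ ξ, Γ ξ (polarSupport p ξ) ∂lam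

/-- The functional on the reciprocals of the support functions which is minimized. -/
def supportFunctional (Ψ : Sphere n → ℝ → ℝ) (μ : Measure (Sphere n)) (p : C(Sphere n, ℝ)) : ℝ :=
  ∫ u, Ψ u (p u)⁻¹ ∂μ

lemma dualFunctional_invSupport_wulffBody {q : C(Sphere n, ℝ)} (hq : ∀ u, 0 < q u) :
    dualFunctional Γ lam (invSupport (wulffBody_mem hq)) = dualFunctional Γ lam q := by
  simp only [dualFunctional, polarSupport_invSupport_wulffBody hq]

section Existence

variable {Γ Ψ : Sphere n → ℝ → ℝ} {lam μ : Measure (Sphere n)} [IsFiniteMeasure lam]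
  [IsFiniteMeasure μ]

/-- The a priori bound applies twice: to g_p ≥ p(u) u·ξ against λ, bounding p above, and to h_K(u) ≥
ρ_K(v) v·u against μ, bounding ρ_K and so h_K above. It needs a lower bound on the integrand. The
positive one of Γ, Ψ starts with the bound 0, and the resulting estimate bounds the other integrand
from below by monotonicity. -/
lemma exists_bounds_of_functionals_le (hΨ : ClassCI Ψ) (hΨlim : ∀ ξ, Tendsto (Ψ ξ) atTop atTop)
    (hΓ : ClassCI Γ) (hΓlim : ∀ ξ, Tendsto (Γ ξ) atTop atTop)
    (hpos : (∀ ξ t, 0 < t → 0 < Γ ξ t) ∨ (∀ ξ t, 0 < t → 0 < Ψ ξ t))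
    (hlam : NotConcentratedOnHemisphere lam) (hμ : NotConcentratedOnHemisphere μ) (c M : ℝ) :
    ∃ a b : ℝ, 0 < a ∧ ∀ (K : ConvexBody (Space n)) (hK : K ∈ bodiesAroundOrigin n),
      dualFunctional Γ lam (invSupport hK) ≤ c → supportFunctional Ψ μ (invSupport hK) ≤ M →
      ∀ u, invSupport hK u ∈ Icc a b := by
  have hdual : ∀ B : ℝ, ∃ T > 0, ∀ (K : ConvexBody (Space n)) (hK : K ∈ bodiesAroundOrigin n),
      dualFunctional Γ lam (invSupport hK) ≤ c →
      (∀ ξ : Sphere n, -B ≤ Γ ξ (polarSupport (invSupport hK) ξ)) →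
      ∀ u, invSupport hK u ≤ T := by
    intro B
    obtain ⟨T, hT, h⟩ := hΓ.exists_apriori_bound hΓlim hlam B c
    exact ⟨T, hT, fun K hK hc hB u => h _ u _
      ((continuous_polarSupport _).comp continuous_subtype_val)
      (polarSupport_sphere_pos (invSupport_pos hK))
      (fun ξ => le_polarSupport _ _ u) hB hc⟩
  have hsupp : ∀ B : ℝ, ∃ T > 0, ∀ (K : ConvexBody (Space n)) (hK : K ∈ bodiesAroundOrigin n),
      supportFunctional Ψ μ (invSupport hK) ≤ M →
      (∀ u : Sphere n, -B ≤ Ψ u (supportFunction K u)) →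
      ∀ ξ : Sphere n, radialFunction K ξ ≤ T := by
    intro B
    obtain ⟨T, hT, h⟩ := hΨ.exists_apriori_bound hΨlim hμ B M
    refine ⟨T, hT, fun K hK hM hB ξ => h _ ξ (fun u : Sphere n => supportFunction K u)
      ((continuous_supportFunction K).comp continuous_subtype_val)
      (supportFunction_pos hK) (fun u => radialFunction_mul_inner_le hK ξ u) hB ?_⟩
    simpa only [supportFunctional, invSupport_apply, inv_inv] using hM
  have hge : ∀ (K : ConvexBody (Space n)) (hK : K ∈ bodiesAroundOrigin n) (T : ℝ),
      (∀ ξ : Sphere n, radialFunction K ξ ≤ T) → ∀ u, T⁻¹ ≤ invSupport hK u :=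
    fun K hK T h u => inv_anti₀ (supportFunction_pos hK u)
      (supportFunction_le_of_radialFunction_le hK h u)
  rcases hpos with hpos | hpos
  · obtain ⟨T₁, hT₁, h₁⟩ := hdual 0
    obtain ⟨L, hL0, hL⟩ := hΨ.toClassC.exists_bound T₁⁻¹ (inv_pos.2 hT₁)
    obtain ⟨T₂, hT₂, h₂⟩ := hsupp L
    refine ⟨T₂⁻¹, T₁, inv_pos.2 hT₂, fun K hK hc hM u => ?_⟩
    have hb : ∀ u, invSupport hK u ≤ T₁ := h₁ K hK hc fun ξ => by
      rw [neg_zero]; exact (hpos _ _ (polarSupport_sphere_pos (invSupport_pos hK) ξ)).le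
    refine ⟨hge K hK T₂ (h₂ K hK hM fun v => ?_) u, hb u⟩
    have h3 : T₁⁻¹ ≤ supportFunction K v :=
      inv_le_of_inv_le₀ (supportFunction_pos hK v) (hb v)
    have h4 := (abs_le.1 (hL v T₁⁻¹ ⟨le_rfl, le_rfl⟩).1).1
    exact h4.trans (hΨ.monotoneOn v (inv_pos.2 hT₁) (supportFunction_pos hK v) h3)
  · obtain ⟨T₂, hT₂, h₂⟩ := hsupp 0
    obtain ⟨L, hL0, hL⟩ := hΓ.toClassC.exists_bound T₂⁻¹ (inv_pos.2 hT₂)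
    obtain ⟨T₁, hT₁, h₁⟩ := hdual L
    refine ⟨T₂⁻¹, T₁, inv_pos.2 hT₂, fun K hK hc hM u => ?_⟩
    have hb : ∀ ξ : Sphere n, radialFunction K ξ ≤ T₂ := h₂ K hK hM fun v => by
      rw [neg_zero]; exact (hpos _ _ (supportFunction_pos hK v)).le
    refine ⟨hge K hK T₂ hb u, h₁ K hK hc (fun ξ => ?_) u⟩
    have hg := polarSupport_sphere_pos (invSupport_pos hK) ξ
    have h3 : T₂⁻¹ ≤ polarSupport (invSupport hK) ξ :=
      inv_le_of_inv_le₀ hg (radialFunction_eq hK ξ ▸ hb ξ)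
    have h4 := (abs_le.1 (hL ξ T₂⁻¹ ⟨le_rfl, le_rfl⟩).1).1
    exact h4.trans (hΓ.monotoneOn ξ (inv_pos.2 hT₂) hg h3)

/-- Since K lies in the ball of radius 1/a, its support function is 1/a-Lipschitz; taking
reciprocals costs a factor of at most b². -/
lemma abs_invSupport_sub_le {K : ConvexBody (Space n)} (hK : K ∈ bodiesAroundOrigin n) {a b : ℝ}
    (ha : 0 < a) (hab : ∀ u, invSupport hK u ∈ Icc a b) (u v : Sphere n) :
    |invSupport hK u - invSupport hK v| ≤ b ^ 2 * a⁻¹ * dist u v := by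
  have hb : 0 ≤ b := ha.le.trans ((hab u).1.trans (hab u).2)
  have hle : ∀ u : Sphere n, supportFunction K u ≤ a⁻¹ := fun u =>
    le_inv_of_le_inv₀ ha (hab u).1
  have h1 := abs_supportFunction_sub_le (K := K) (T := a⁻¹)
    (fun y hy => norm_le_of_mem hK (radialFunction_le_of_supportFunction_le hK hle) hy)
    (v : Space n) (u : Space n)
  have hu := supportFunction_pos hK u
  have hv := supportFunction_pos hK v
  have h2 : invSupport hK u - invSupport hK v =
      invSupport hK u * invSupport hK v * (supportFunction K v - supportFunction K u) := by
    rw [invSupport_apply, invSupport_apply]; field_simp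
  rw [h2, abs_mul, abs_of_pos (mul_pos (invSupport_pos hK u) (invSupport_pos hK v)), sq,
    mul_assoc (b * b)]
  refine mul_le_mul (mul_le_mul (hab u).2 (hab v).2 (invSupport_pos hK v).le hb) ?_
    (abs_nonneg _) (mul_nonneg hb hb)
  rwa [dist_comm, ← Subtype.dist_eq] at h1

lemma supportFunctional_invSupport_wulffBody_le (hΨ : ClassCI Ψ) {q : C(Sphere n, ℝ)}
    (hq : ∀ u, 0 < q u) :
    supportFunctional Ψ μ (invSupport (wulffBody_mem hq)) ≤ supportFunctional Ψ μ q := by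
  have hpos := invSupport_pos (wulffBody_mem hq)
  refine integral_mono (hΨ.toClassC.integrable μ ((map_continuous _).inv₀ fun u => (hpos u).ne')
    fun u => inv_pos.2 (hpos u)) (hΨ.toClassC.integrable μ ((map_continuous _).inv₀
    fun u => (hq u).ne') fun u => inv_pos.2 (hq u)) fun u => ?_
  exact hΨ.monotoneOn u (inv_pos.2 (hpos u)) (inv_pos.2 (hq u))
    (inv_anti₀ (hq u) (le_invSupport_wulffBody hq u))

/-- Existence of a solution of the constrained minimization problem. -/
lemma exists_minimizer (hΨ : ClassCI Ψ) (hΨlim : ∀ ξ, Tendsto (Ψ ξ) atTop atTop)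
    (hΓ : ClassCI Γ) (hΓlim : ∀ ξ, Tendsto (Γ ξ) atTop atTop)
    (hpos : (∀ ξ t, 0 < t → 0 < Γ ξ t) ∨ (∀ ξ t, 0 < t → 0 < Ψ ξ t))
    (hlam : NotConcentratedOnHemisphere lam) (hμ : NotConcentratedOnHemisphere μ) :
    ∃ (K : ConvexBody (Space n)) (hK : K ∈ bodiesAroundOrigin n),
      ∀ q : C(Sphere n, ℝ), (∀ u, 0 < q u) →
        dualFunctional Γ lam q ≤ dualFunctional Γ lam (invSupport hK) →
        supportFunctional Ψ μ (invSupport hK) ≤ supportFunctional Ψ μ q := by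
  set c := dualFunctional Γ lam (1 : C(Sphere n, ℝ)) with hc
  set M := supportFunctional Ψ μ (1 : C(Sphere n, ℝ)) with hM
  obtain ⟨a, b, ha, hab⟩ := exists_bounds_of_functionals_le hΨ hΨlim hΓ hΓlim hpos hlam hμ c M
  set S : Set C(Sphere n, ℝ) := {p | (∀ u, p u ∈ Icc a b) ∧
      ∀ u v, |p u - p v| ≤ b ^ 2 * a⁻¹ * dist u v} with hS
  have hScomp : IsCompact S := isCompact_setOf_bounded_lipschitz a b (by positivity)
  have hSpos : ∀ p ∈ S, ∀ u, 0 < p u := fun p hp u => ha.trans_le (hp.1 u).1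
  have hmem : ∀ (K : ConvexBody (Space n)) (hK : K ∈ bodiesAroundOrigin n),
      dualFunctional Γ lam (invSupport hK) ≤ c → supportFunctional Ψ μ (invSupport hK) ≤ M →
      invSupport hK ∈ S := fun K hK h1 h2 =>
    ⟨hab K hK h1 h2, abs_invSupport_sub_le hK ha (hab K hK h1 h2)⟩
  have hEcont : ContinuousOn (dualFunctional Γ lam) S := by
    refine hΓ.toClassC.continuousOn_integral lam (y := fun (p : C(Sphere n, ℝ)) (ξ : Sphere n) =>
      polarSupport p ξ) (b := b)
      (continuous_polarSupport_uncurry.comp (by fun_prop :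
        Continuous fun q : C(Sphere n, ℝ) × Sphere n => (q.1, (q.2 : Space n)))) ha ?_
    refine fun p hp ξ => ⟨(hp.1 ξ).1.trans (apply_le_polarSupport p ξ), ?_⟩
    refine polarSupport_le_iff.2 fun u => ?_
    calc p u * inner ℝ (u : Space n) (ξ : Space n) ≤ p u * 1 :=
          mul_le_mul_of_nonneg_left (inner_le_one_sphere u ξ) (hSpos p hp u).le
      _ ≤ b := by rw [mul_one]; exact (hp.1 u).2
  have hFcont : ContinuousOn (supportFunctional Ψ μ) S :=
    hΨ.toClassC.inv.continuousOn_integral μ (y := fun (p : C(Sphere n, ℝ)) (u : Sphere n) => p u)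
      (b := b) (by fun_prop) ha fun p hp => hp.1
  have hA : IsCompact (S ∩ dualFunctional Γ lam ⁻¹' Iic c) :=
    hScomp.of_isClosed_subset
      (hEcont.preimage_isClosed_of_isClosed hScomp.isClosed isClosed_Iic) inter_subset_left
  have hone : ∀ u : Sphere n, 0 < (1 : C(Sphere n, ℝ)) u := fun u => one_pos
  have hone' : invSupport (wulffBody_mem hone) ∈ S ∩ dualFunctional Γ lam ⁻¹' Iic c :=
    ⟨hmem _ _ (dualFunctional_invSupport_wulffBody hone).le
      (supportFunctional_invSupport_wulffBody_le hΨ hone),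
      (dualFunctional_invSupport_wulffBody hone).le⟩
  obtain ⟨p, hpA, hpmin⟩ := hA.exists_isMinOn ⟨_, hone'⟩ (hFcont.mono inter_subset_left)
  have hp := hSpos p hpA.1
  refine ⟨wulffBody p hp, wulffBody_mem hp, fun q hq hqE => ?_⟩
  refine (supportFunctional_invSupport_wulffBody_le hΨ hp).trans ?_
  rw [dualFunctional_invSupport_wulffBody hp] at hqE
  have hqc : dualFunctional Γ lam q ≤ c := hqE.trans hpA.2
  -- The compactness bounds cover only objective values at most M. A larger value is beaten by the
  -- competitor coming from the constant function 1.
  by_cases hqM : supportFunctional Ψ μ q ≤ M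
  · have hle := supportFunctional_invSupport_wulffBody_le (μ := μ) hΨ hq
    have hE := dualFunctional_invSupport_wulffBody (Γ := Γ) (lam := lam) hq
    refine le_trans (hpmin ⟨hmem _ (wulffBody_mem hq) (hE.le.trans hqc) (hle.trans hqM), ?_⟩) hle
    exact hE.le.trans hqc
  · refine le_trans (hpmin hone') ?_
    exact (supportFunctional_invSupport_wulffBody_le hΨ hone).trans (not_le.1 hqM).le

end Existence

end Minimization

/-! ### First variation of the two functionals. -/

section Variation

variable {n : ℕ} [Nonempty (Sphere n)]

lemma polarSupport_add_smul_le (p φ : C(Sphere n, ℝ)) (t : ℝ) (x : Space n) :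
    ∃ u : Sphere n, polarSupport (p + t • φ) x ≤
        polarSupport p x + t * (φ u * inner ℝ (u : Space n) x) ∧
      polarSupport (p + t • φ) x =
        p u * inner ℝ (u : Space n) x + t * (φ u * inner ℝ (u : Space n) x) := by
  obtain ⟨u, hu⟩ := exists_polarSupport_eq (p + t • φ) x
  have h1 : (p + t • φ) u * inner ℝ (u : Space n) x =
      p u * inner ℝ (u : Space n) x + t * (φ u * inner ℝ (u : Space n) x) := by
    simp only [ContinuousMap.add_apply, ContinuousMap.smul_apply, smul_eq_mul]; ring
  rw [h1] at hu
  refine ⟨u, ?_, hu⟩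
  rw [hu]
  linarith [le_polarSupport p x u]

lemma abs_polarSupport_add_smul_sub_le (p φ : C(Sphere n, ℝ)) {t : ℝ} (ht : 0 ≤ t)
    (ξ : Sphere n) : |polarSupport (p + t • φ) ξ - polarSupport p ξ| ≤ ‖φ‖ * t := by
  obtain ⟨u, hu, -⟩ := polarSupport_add_smul_le p φ t (ξ : Space n)
  obtain ⟨v, hv⟩ := exists_polarSupport_eq p (ξ : Space n)
  have h2 := le_polarSupport_add_smul p φ (t := t) hv
  have h3 := (abs_le.1 (abs_mul_inner_le φ u ξ)).2
  have h4 := (abs_le.1 (abs_mul_inner_le φ v ξ)).1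
  rw [abs_le]
  constructor <;> nlinarith

/-- The derivative of the polar support function, at a point where the maximizer is unique. -/
lemma tendsto_slope_polarSupport (p φ : C(Sphere n, ℝ)) {ξ v : Sphere n}
    (hv : ∀ u, polarSupport p ξ = p u * inner ℝ (u : Space n) (ξ : Space n) ↔ u = v) :
    Tendsto (fun t : ℝ => t⁻¹ * (polarSupport (p + t • φ) ξ - polarSupport p ξ)) (𝓝[>] 0)
      (𝓝 (φ v * inner ℝ (v : Space n) (ξ : Space n))) := by
  choose u hu hu' using fun t : ℝ => polarSupport_add_smul_le p φ t (ξ : Space n)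
  have hv0 := (hv v).2 rfl
  -- A maximizer `u t` of the perturbed problem is within 2‖φ‖t of optimal for the original one.
  have htu : Tendsto (fun t => p (u t) * inner ℝ (u t : Space n) (ξ : Space n)) (𝓝[>] 0)
      (𝓝 (polarSupport p ξ)) := by
    have hb : Tendsto (fun t : ℝ => polarSupport p ξ - 2 * ‖φ‖ * t) (𝓝[>] 0)
        (𝓝 (polarSupport p ξ)) := by
      have : Continuous fun t : ℝ => polarSupport p ξ - 2 * ‖φ‖ * t := by fun_prop
      simpa using (this.tendsto 0).mono_left nhdsWithin_le_nhds
    refine tendsto_of_tendsto_of_tendsto_of_le_of_le' hb tendsto_const_nhds ?_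
      (Eventually.of_forall fun t => le_polarSupport _ _ _)
    filter_upwards [self_mem_nhdsWithin] with t ht
    have ht' : 0 < t := ht
    have h1 := (abs_le.1 (abs_polarSupport_add_smul_sub_le p φ ht'.le ξ)).1
    have h2 := (abs_le.1 (abs_mul_inner_le φ (u t) ξ)).2
    have h3 := hu' t
    nlinarith
  -- Outside a neighbourhood of the unique maximizer v, compactness leaves a positive gap below the
  -- maximum, so near-optimal points must converge to v.
  have hlim : Tendsto u (𝓝[>] 0) (𝓝 v) := by
    rw [tendsto_nhds]
    intro U hU hvU
    rcases (Uᶜ).eq_empty_or_nonempty with hE | hE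
    · rw [compl_empty_iff.1 hE]; exact univ_mem
    obtain ⟨z, hz, hzmax⟩ := hU.isClosed_compl.isCompact.exists_isMaxOn hE
      (continuous_polarSupport_aux p (ξ : Space n)).continuousOn
    have hlt : p z * inner ℝ (z : Space n) (ξ : Space n) < polarSupport p ξ := by
      refine lt_of_le_of_ne (le_polarSupport _ _ _) fun h => hz ?_
      rw [(hv z).1 h.symm]; exact hvU
    filter_upwards [htu.eventually (lt_mem_nhds hlt)] with t ht
    by_contra hn
    exact absurd (hzmax hn) (not_le.2 ht)
  have hup : Tendsto (fun t => φ (u t) * inner ℝ (u t : Space n) (ξ : Space n)) (𝓝[>] 0)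
      (𝓝 (φ v * inner ℝ (v : Space n) (ξ : Space n))) :=
    ((continuous_polarSupport_aux φ (ξ : Space n)).tendsto v).comp hlim
  -- Testing the perturbed maximum at v bounds the quotient from below; testing the original one at
  -- `u t` bounds it from above.
  refine tendsto_of_tendsto_of_tendsto_of_le_of_le' tendsto_const_nhds hup ?_ ?_
  · filter_upwards [self_mem_nhdsWithin] with t ht
    rw [le_inv_mul_iff₀ ht]
    linarith [le_polarSupport_add_smul p φ (t := t) hv0]
  · filter_upwards [self_mem_nhdsWithin] with t ht
    rw [inv_mul_le_iff₀ ht]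
    linarith [hu t]

/-- If `f ≥ 0` wherever `e < 0`, then `f` is a multiple of `e`. -/
lemma eq_mul_of_nonneg_of_neg {V : Type*} [AddCommGroup V] [Module ℝ V] (f e : V →ₗ[ℝ] ℝ)
    {v₀ : V} (hv₀ : 0 < e v₀) (h : ∀ v, e v < 0 → 0 ≤ f v) (v : V) :
    f v = f v₀ / e v₀ * e v := by
  have key : ∀ v, f v₀ / e v₀ * e v ≤ f v := by
    intro v
    have h1 : ∀ ε > 0, f v₀ / e v₀ * e v ≤ f v + ε * -(f v₀) := by
      intro ε hε
      -- The multiple of `v₀` is chosen so that e takes the value -ε e(v₀); letting ε tend to 0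
      -- gives the inequality, and -v gives its reverse.
      have h2 : e (v - (e v / e v₀ + ε) • v₀) < 0 := by
        rw [map_sub, map_smul, smul_eq_mul, add_mul, div_mul_cancel₀ _ hv₀.ne']
        nlinarith
      have h3 := h _ h2
      rw [map_sub, map_smul, smul_eq_mul, add_mul] at h3
      have h4 : e v / e v₀ * f v₀ = f v₀ / e v₀ * e v := by ring
      rw [h4] at h3
      linarith
    have h5 : Tendsto (fun ε : ℝ => f v + ε * -(f v₀)) (𝓝[>] 0) (𝓝 (f v)) := by
      have : Continuous fun ε : ℝ => f v + ε * -(f v₀) := by fun_prop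
      simpa using (this.tendsto 0).mono_left nhdsWithin_le_nhds
    exact ge_of_tendsto h5 (eventually_nhdsWithin_of_forall h1)
  apply le_antisymm _ (key v)
  have := key (-v)
  rw [map_neg, map_neg] at this
  linarith

section EulerLagrange

variable {Γ Ψ : Sphere n → ℝ → ℝ} {lam μ : Measure (Sphere n)} [IsFiniteMeasure lam]
  [IsFiniteMeasure μ]

lemma exists_forall_mem_Icc {q : Sphere n → ℝ} (hq : Continuous q) (hpos : ∀ u, 0 < q u) :
    ∃ a b : ℝ, 0 < a ∧ ∀ u, q u ∈ Icc a b := by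
  obtain ⟨u, -, hu⟩ := isCompact_univ.exists_isMinOn univ_nonempty hq.continuousOn
  obtain ⟨v, -, hv⟩ := isCompact_univ.exists_isMaxOn univ_nonempty hq.continuousOn
  exact ⟨q u, q v, hpos u, fun w => ⟨hu (mem_univ w), hv (mem_univ w)⟩⟩

lemma tendsto_slope_supportFunctional (hΨ : ClassC Ψ) {p : C(Sphere n, ℝ)} (hp : ∀ u, 0 < p u)
    (φ : C(Sphere n, ℝ)) :
    Tendsto (fun t : ℝ => t⁻¹ * (supportFunctional Ψ μ (p + t • φ) - supportFunctional Ψ μ p))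
      (𝓝[>] 0) (𝓝 (∫ u, deriv (fun s => Ψ u s⁻¹) (p u) * φ u ∂μ)) := by
  obtain ⟨a, b, ha, hab⟩ := exists_forall_mem_Icc (map_continuous p) hp
  have hB : ∀ t > 0, ∀ u, |(p + t • φ) u - p u| ≤ ‖φ‖ * t := fun t ht u => by
    simp only [ContinuousMap.add_apply, ContinuousMap.smul_apply, smul_eq_mul, add_sub_cancel_left]
    rw [abs_mul, abs_of_pos ht, mul_comm]
    exact mul_le_mul_of_nonneg_right (φ.norm_coe_le_norm u) ht.le
  refine hΨ.inv.tendsto_integral_slope μ (y := fun t u => (p + t • φ) u) (map_continuous p)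
    (fun t => map_continuous _) (half_pos ha)
    (fun u => ⟨by linarith [(hab u).1], (hab u).2.trans (by linarith : b ≤ b + a / 2)⟩)
    (eventually_add_smul_mem ha hab hB) (eventually_nhdsWithin_of_forall hB)
    (Eventually.of_forall fun u => tendsto_const_nhds.congr' ?_)
  filter_upwards [self_mem_nhdsWithin] with t ht
  have ht' : t ≠ 0 := ne_of_gt ht
  simp only [ContinuousMap.add_apply, ContinuousMap.smul_apply, smul_eq_mul, add_sub_cancel_left]
  field_simp

lemma tendsto_slope_dualFunctional (hΓ : ClassC Γ) {K : ConvexBody (Space n)}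
    (hK : K ∈ bodiesAroundOrigin n) (hac : lam ≪ sphericalMeasure n) (φ : C(Sphere n, ℝ)) :
    Tendsto (fun t : ℝ => t⁻¹ *
      (dualFunctional Γ lam (invSupport hK + t • φ) - dualFunctional Γ lam (invSupport hK)))
      (𝓝[>] 0) (𝓝 (∫ ξ, deriv (Γ ξ) (polarSupport (invSupport hK) ξ) *
        (φ (radialGaussMap K ξ) *
          inner ℝ (radialGaussMap K ξ : Space n) (ξ : Space n)) ∂lam)) := by
  have hc : ∀ q : C(Sphere n, ℝ), Continuous fun ξ : Sphere n => polarSupport q ξ :=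
    fun q => (continuous_polarSupport q).comp continuous_subtype_val
  obtain ⟨a, b, ha, hab⟩ := exists_forall_mem_Icc (hc (invSupport hK))
    (polarSupport_sphere_pos (invSupport_pos hK))
  have hB : ∀ t > 0, ∀ ξ : Sphere n, |polarSupport (invSupport hK + t • φ) ξ -
      polarSupport (invSupport hK) ξ| ≤ ‖φ‖ * t :=
    fun t ht ξ => abs_polarSupport_add_smul_sub_le _ φ (le_of_lt ht) ξ
  refine hΓ.tendsto_integral_slope lam
    (y := fun (t : ℝ) (ξ : Sphere n) => polarSupport (invSupport hK + t • φ) ξ) (hc _)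
    (fun t => hc _) (half_pos ha)
    (fun u => ⟨by linarith [(hab u).1], (hab u).2.trans (by linarith : b ≤ b + a / 2)⟩)
    (eventually_add_smul_mem ha hab hB) (eventually_nhdsWithin_of_forall hB) ?_
  filter_upwards [ae_radialGaussImage_eq hK hac] with ξ hξ
  refine tendsto_slope_polarSupport _ φ fun u => ?_
  rw [← mem_radialGaussImage_iff hK, hξ.1, mem_singleton_iff]

/-- A negative derivative of the constraint keeps p + tφ admissible for small t > 0, so minimality
makes the difference quotients of the objective nonnegative. -/
lemma nonneg_derivative_of_minimizer (hΨ : ClassC Ψ) (hΓ : ClassC Γ)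
    {K : ConvexBody (Space n)} (hK : K ∈ bodiesAroundOrigin n) (hac : lam ≪ sphericalMeasure n)
    (hmin : ∀ q : C(Sphere n, ℝ), (∀ u, 0 < q u) →
      dualFunctional Γ lam q ≤ dualFunctional Γ lam (invSupport hK) →
      supportFunctional Ψ μ (invSupport hK) ≤ supportFunctional Ψ μ q) (φ : C(Sphere n, ℝ))
    (hφ : ∫ ξ, deriv (Γ ξ) (polarSupport (invSupport hK) ξ) * (φ (radialGaussMap K ξ) *
      inner ℝ (radialGaussMap K ξ : Space n) (ξ : Space n)) ∂lam < 0) :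
    0 ≤ ∫ u, deriv (fun s => Ψ u s⁻¹) (invSupport hK u) * φ u ∂μ := by
  refine ge_of_tendsto (tendsto_slope_supportFunctional hΨ (invSupport_pos hK) φ) ?_
  obtain ⟨a, b, ha, hab⟩ := exists_forall_mem_Icc (map_continuous (invSupport hK))
    (invSupport_pos hK)
  have hB : ∀ t > 0, ∀ u, |(invSupport hK + t • φ) u - invSupport hK u| ≤ ‖φ‖ * t :=
    fun t ht u => by
      simp only [ContinuousMap.add_apply, ContinuousMap.smul_apply, smul_eq_mul,
        add_sub_cancel_left]
      rw [abs_mul, abs_of_pos ht, mul_comm]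
      exact mul_le_mul_of_nonneg_right (φ.norm_coe_le_norm u) ht.le
  filter_upwards [(tendsto_slope_dualFunctional hΓ hK hac φ).eventually (gt_mem_nhds hφ),
    eventually_add_smul_mem (y := fun (t : ℝ) u => (invSupport hK + t • φ) u) ha hab hB,
    self_mem_nhdsWithin] with t h1 h2 h3
  have h3' : 0 < t := h3
  have h4 : dualFunctional Γ lam (invSupport hK + t • φ) <
      dualFunctional Γ lam (invSupport hK) := by
    by_contra hn
    exact absurd h1 (not_lt.2 (mul_nonneg (inv_nonneg.2 h3'.le) (sub_nonneg.2 (not_lt.1 hn))))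
  have h5 := hmin _ (fun u => (half_pos ha).trans_le (h2 u).1) h4.le
  exact mul_nonneg (inv_nonneg.2 h3'.le) (sub_nonneg.2 h5)

end EulerLagrange

end Variation

/-! ### From the Euler–Lagrange equation to the measure identity, and the converse. -/

section Solution

variable {n : ℕ} [Nonempty (Sphere n)]

section Density

variable {G Ψ : Sphere n → ℝ → ℝ} {lam μ : Measure (Sphere n)} [IsFiniteMeasure lam]
  [IsFiniteMeasure μ] {K : ConvexBody (Space n)}

lemma integrable_comp_radialGaussMap (hK : K ∈ bodiesAroundOrigin n)
    (hac : lam ≪ sphericalMeasure n) {k : Sphere n × Sphere n → ℝ} (hk : Continuous k) :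
    Integrable (fun ξ => k (ξ, radialGaussMap K ξ)) lam := by
  obtain ⟨L, hL⟩ := isCompact_univ.exists_bound_of_continuousOn hk.continuousOn
  exact Integrable.of_bound (hk.measurable.comp_aemeasurable
    (aemeasurable_id.prodMk (aemeasurable_radialGaussMap hK hac))).aestronglyMeasurable L
    (Eventually.of_forall fun ξ => hL _ (mem_univ _))

lemma continuous_gaussImageDensity_kernel (hG : ClassC G) (hΨ : ClassCI Ψ)
    (hK : K ∈ bodiesAroundOrigin n) :
    Continuous fun q : Sphere n × Sphere n =>
      radialFunction K (q.1 : Space n) * deriv (G q.1) (radialFunction K (q.1 : Space n)) /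
        (supportFunction K q.2 * deriv (Ψ q.2) (supportFunction K q.2)) := by
  have h1 := (continuous_radialFunction hK).comp (continuous_fst (X := Sphere n) (Y := Sphere n))
  have h2 := ((continuous_supportFunction K).comp continuous_subtype_val).comp
    (continuous_snd (X := Sphere n) (Y := Sphere n))
  refine Continuous.div (h1.mul (hG.continuous_deriv_comp continuous_fst h1
    fun q => radialFunction_pos hK q.1)) (h2.mul (hΨ.toClassC.continuous_deriv_comp continuous_snd
    h2 fun q => supportFunction_pos hK q.2)) fun q => ?_
  exact (mul_pos (supportFunction_pos hK q.2)
    (hΨ.deriv_pos _ _ (supportFunction_pos hK q.2))).ne'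

lemma gaussImageDensity_neg (hG : ClassCd G) (hΨ : ClassCI Ψ) (hK : K ∈ bodiesAroundOrigin n)
    (ξ : Sphere n) : gaussImageDensity G Ψ K ξ < 0 := by
  refine div_neg_of_neg_of_pos ?_ ?_
  · exact mul_neg_of_pos_of_neg (radialFunction_pos hK ξ)
      (hG.deriv_neg _ _ (radialFunction_pos hK ξ))
  · exact mul_pos (supportFunction_pos hK _) (hΨ.deriv_pos _ _ (supportFunction_pos hK _))

lemma integrable_gaussImageDensity_mul (hG : ClassC G) (hΨ : ClassCI Ψ)
    (hK : K ∈ bodiesAroundOrigin n) (hac : lam ≪ sphericalMeasure n) {ψ : Sphere n → ℝ}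
    (hψ : Continuous ψ) :
    Integrable (fun ξ => gaussImageDensity G Ψ K ξ * ψ (radialGaussMap K ξ)) lam :=
  integrable_comp_radialGaussMap hK hac
    ((continuous_gaussImageDensity_kernel hG hΨ hK).mul (hψ.comp continuous_snd))

lemma integrable_gaussImageDensity (hG : ClassC G) (hΨ : ClassCI Ψ)
    (hK : K ∈ bodiesAroundOrigin n) (hac : lam ≪ sphericalMeasure n) :
    Integrable (gaussImageDensity G Ψ K) lam :=
  integrable_comp_radialGaussMap hK hac (continuous_gaussImageDensity_kernel hG hΨ hK)

lemma integral_gaussImageDensity_neg (hG : ClassCd G) (hΨ : ClassCI Ψ)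
    (hK : K ∈ bodiesAroundOrigin n) (hac : lam ≪ sphericalMeasure n) (hlam : lam ≠ 0) :
    ∫ ξ, gaussImageDensity G Ψ K ξ ∂lam < 0 := by
  have h1 : 0 < ∫ ξ, -gaussImageDensity G Ψ K ξ ∂lam := by
    rw [integral_pos_iff_support_of_nonneg
      (fun ξ => (neg_pos.2 (gaussImageDensity_neg hG hΨ hK ξ)).le)
      (integrable_gaussImageDensity hG.toClassC hΨ hK hac).neg]
    have : Function.support (fun ξ => -gaussImageDensity G Ψ K ξ) = univ :=
      eq_univ_of_forall fun ξ => (neg_pos.2 (gaussImageDensity_neg hG hΨ hK ξ)).ne'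
    rw [this]
    exact Measure.measure_univ_pos.2 hlam
  rw [integral_neg] at h1
  linarith

/-- Since α·ξ = h_K(α)/ρ_K(ξ), both sides equal -ρ_K G_t h_K(α). This is where the density of the
image measure comes from. -/
lemma deriv_polarSupport_mul_inner_eq (hG : ClassC G) (hΨ : ClassCI Ψ)
    (hK : K ∈ bodiesAroundOrigin n) {ξ : Sphere n}
    (hξ : radialGaussMap K ξ ∈ radialGaussImage K ξ) :
    deriv (fun s => G ξ s⁻¹) (polarSupport (invSupport hK) ξ) *
        inner ℝ (radialGaussMap K ξ : Space n) (ξ : Space n) =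
      gaussImageDensity G Ψ K ξ *
        deriv (fun s => Ψ (radialGaussMap K ξ) s⁻¹) (invSupport hK (radialGaussMap K ξ)) := by
  have hg := polarSupport_sphere_pos (invSupport_pos hK) ξ
  have hh := supportFunction_pos hK (radialGaussMap K ξ)
  have hd := hΨ.deriv_pos (radialGaussMap K ξ) _ hh
  have h1 := (mem_radialGaussImage_iff hK ξ _).1 hξ
  rw [(hG.deriv_inv ξ hg).deriv, (hΨ.toClassC.deriv_inv _ (invSupport_pos hK _)).deriv,
    gaussImageDensity, radialFunction_eq hK]
  rw [invSupport_apply] at h1 ⊢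
  rw [inv_inv]
  have h2 : inner ℝ (radialGaussMap K ξ : Space n) (ξ : Space n) =
      polarSupport (invSupport hK) ξ * supportFunction K (radialGaussMap K ξ) := by
    rw [h1]; field_simp
  rw [h2]
  field_simp

/-- The Euler-Lagrange equation of the constrained minimization problem. -/
lemma integral_eq_of_minimizer (hG : ClassCd G) (hΨ : ClassCI Ψ) (hK : K ∈ bodiesAroundOrigin n)
    (hac : lam ≪ sphericalMeasure n) (hlam : lam ≠ 0)
    (hmin : ∀ q : C(Sphere n, ℝ), (∀ u, 0 < q u) →
      dualFunctional (fun ξ s => G ξ s⁻¹) lam q ≤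
        dualFunctional (fun ξ s => G ξ s⁻¹) lam (invSupport hK) →
      supportFunctional Ψ μ (invSupport hK) ≤ supportFunctional Ψ μ q) (ψ : C(Sphere n, ℝ)) :
    ∫ u, ψ u ∂μ = μ.real univ / (∫ ξ, gaussImageDensity G Ψ K ξ ∂lam) *
      ∫ ξ, gaussImageDensity G Ψ K ξ * ψ (radialGaussMap K ξ) ∂lam := by
  have hint : ∀ ψ : C(Sphere n, ℝ),
      Integrable (fun ξ => gaussImageDensity G Ψ K ξ * ψ (radialGaussMap K ξ)) lam :=
    fun ψ => integrable_gaussImageDensity_mul hG.toClassC hΨ hK hac (map_continuous ψ)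
  let f : C(Sphere n, ℝ) →ₗ[ℝ] ℝ :=
    { toFun := fun ψ => ∫ u, ψ u ∂μ
      map_add' := fun ψ χ => integral_add (integrable_of_continuous (map_continuous ψ))
        (integrable_of_continuous (map_continuous χ))
      map_smul' := fun c ψ => integral_const_mul c _ }
  let e : C(Sphere n, ℝ) →ₗ[ℝ] ℝ :=
    { toFun := fun ψ => ∫ ξ, gaussImageDensity G Ψ K ξ * ψ (radialGaussMap K ξ) ∂lam
      map_add' := fun ψ χ => by
        rw [← integral_add (hint ψ) (hint χ)]
        simp only [ContinuousMap.add_apply, mul_add]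
      map_smul' := fun c ψ => by
        rw [RingHom.id_apply, smul_eq_mul, ← integral_const_mul]
        simp only [ContinuousMap.smul_apply, smul_eq_mul, mul_left_comm] }
  have hf1 : f (-1) = -μ.real univ := by
    change ∫ u, (-1 : C(Sphere n, ℝ)) u ∂μ = _
    simp
  have he1 : e (-1) = -∫ ξ, gaussImageDensity G Ψ K ξ ∂lam := by
    change ∫ ξ, gaussImageDensity G Ψ K ξ * (-1 : C(Sphere n, ℝ)) (radialGaussMap K ξ) ∂lam = _
    rw [← integral_neg]
    simp
  have hneg := integral_gaussImageDensity_neg hG hΨ hK hac hlam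
  have hA : Continuous fun u => deriv (fun s => Ψ u s⁻¹) (invSupport hK u) :=
    hΨ.toClassC.inv.continuous_deriv_comp continuous_id (map_continuous _) (invSupport_pos hK)
  have hA0 : ∀ u, deriv (fun s => Ψ u s⁻¹) (invSupport hK u) ≠ 0 := fun u =>
    (hΨ.inv.deriv_neg u _ (invSupport_pos hK u)).ne
  -- The functionals are f(ψ) = ∫ ψ dμ and e(ψ) = ∫ density · ψ(α_K) dλ. The density is negative, so
  -- the constant -1 has e > 0 and fixes the proportionality factor.
  have hkey := eq_mul_of_nonneg_of_neg f e (v₀ := -1) (by rw [he1]; linarith) (fun χ hχ => ?_) ψ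
  · rw [hf1, he1, neg_div_neg_eq] at hkey
    exact hkey
  -- Dividing by the derivative of s ↦ Ψ(u,1/s) turns the first variations of the objective and of
  -- the constraint along φ into f(χ) and e(χ).
  · let φ : C(Sphere n, ℝ) :=
      ⟨fun u => χ u / deriv (fun s => Ψ u s⁻¹) (invSupport hK u), (map_continuous χ).div hA hA0⟩
    have hφ : ∀ u, deriv (fun s => Ψ u s⁻¹) (invSupport hK u) * φ u = χ u := fun u =>
      mul_div_cancel₀ _ (hA0 u)
    have h1 := nonneg_derivative_of_minimizer hΨ.toClassC hG.inv.toClassC hK hac hmin φ ?_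
    · simp only [hφ] at h1
      exact h1
    · refine lt_of_eq_of_lt (integral_congr_ae ?_) hχ
      filter_upwards [ae_radialGaussImage_eq hK hac] with ξ hξ
      have h2 := deriv_polarSupport_mul_inner_eq hG.toClassC hΨ hK
        (hξ.1 ▸ mem_singleton (radialGaussMap K ξ))
      change _ = gaussImageDensity G Ψ K ξ * χ (radialGaussMap K ξ)
      rw [← hφ, mul_left_comm, h2]
      ring

/-- The factor κ is negative like the density, so κ · density · λ is a positive measure. Its
push-forward under α_K has the same integrals of continuous functions as μ, hence equals μ. -/
lemma isSolution_of_integral_eq (hG : ClassCd G) (hΨ : ClassCI Ψ) (hK : K ∈ bodiesAroundOrigin n)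
    (hac : lam ≪ sphericalMeasure n) (hlam : lam ≠ 0)
    (h : ∀ ψ : C(Sphere n, ℝ), ∫ u, ψ u ∂μ =
      μ.real univ / (∫ ξ, gaussImageDensity G Ψ K ξ ∂lam) *
        ∫ ξ, gaussImageDensity G Ψ K ξ * ψ (radialGaussMap K ξ) ∂lam) (hμ : μ ≠ 0) :
    IsSolution G Ψ lam μ K := by
  set I := ∫ ξ, gaussImageDensity G Ψ K ξ ∂lam with hI
  have hI0 : I < 0 := integral_gaussImageDensity_neg hG hΨ hK hac hlam
  have hμ0 : 0 < μ.real univ := by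
    rw [measureReal_def]
    exact ENNReal.toReal_pos (Measure.measure_univ_ne_zero.2 hμ) (measure_ne_top _ _)
  set κ := μ.real univ / I with hκ
  have hκ0 : κ < 0 := div_neg_of_pos_of_neg hμ0 hI0
  have hα := aemeasurable_radialGaussMap (K := K) hK hac
  have hDint := integrable_gaussImageDensity (lam := lam) hG.toClassC hΨ hK hac
  have hDpos : ∀ ξ, 0 < κ * gaussImageDensity G Ψ K ξ := fun ξ =>
    mul_pos_of_neg_of_neg hκ0 (gaussImageDensity_neg hG hΨ hK ξ)
  have hDm : AEMeasurable (fun ξ => ENNReal.ofReal (κ * gaussImageDensity G Ψ K ξ)) lam :=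
    (hDint.const_mul κ).aestronglyMeasurable.aemeasurable.ennreal_ofReal
  set ν₀ := lam.withDensity fun ξ => ENNReal.ofReal (κ * gaussImageDensity G Ψ K ξ) with hν₀
  have : IsFiniteMeasure ν₀ := isFiniteMeasure_withDensity_ofReal (hDint.const_mul κ).2
  have hα₀ : AEMeasurable (radialGaussMap K) ν₀ := hα.mono_ac (withDensity_absolutelyContinuous _ _)
  have hνint : ∀ f : Sphere n → ℝ, Measurable f → ∫ u, f u ∂(ν₀.map (radialGaussMap K)) =
      κ * ∫ ξ, gaussImageDensity G Ψ K ξ * f (radialGaussMap K ξ) ∂lam := by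
    intro f hf
    rw [integral_map hα₀ hf.aestronglyMeasurable, hν₀,
      integral_withDensity_eq_integral_toReal_smul₀ hDm
        (Eventually.of_forall fun _ => ENNReal.ofReal_lt_top), ← integral_const_mul]
    refine integral_congr_ae (Eventually.of_forall fun ξ => ?_)
    simp only [ENNReal.toReal_ofReal (hDpos ξ).le, smul_eq_mul, mul_assoc]
  have hμν : μ = ν₀.map (radialGaussMap K) := by
    have : IsFiniteMeasure (ν₀.map (radialGaussMap K)) := Measure.isFiniteMeasure_map _ _
    refine ext_of_forall_integral_eq_of_IsFiniteMeasure fun f => ?_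
    rw [hνint f f.continuous.measurable]
    exact h f.toContinuousMap
  have hset : ∀ ω : Set (Sphere n), MeasurableSet ω →
      μ.real ω = κ * gaussImageMeasure G Ψ lam K ω := by
    intro ω hω
    have h1 : μ.real ω = ∫ u, ω.indicator (fun _ => (1 : ℝ)) u ∂μ := by
      rw [integral_indicator_const _ hω, smul_eq_mul, mul_one]
    rw [h1, hμν, hνint _ (measurable_const.indicator hω), gaussImageMeasure,
      setIntegral_congr_set (reverseRadialGaussImage_ae_eq hK hac ω),
      ← integral_indicator₀ (hα.nullMeasurableSet_preimage hω)]
    congr 1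
    refine integral_congr_ae (Eventually.of_forall fun ξ => ?_)
    by_cases hξ : radialGaussMap K ξ ∈ ω
    · simp [hξ]
    · simp [hξ]
  have huniv := hset univ MeasurableSet.univ
  have hne : gaussImageMeasure G Ψ lam K univ ≠ 0 := by
    intro h0
    rw [h0, mul_zero] at huniv
    exact hμ0.ne' huniv
  refine ⟨hne, fun ω hω => ?_⟩
  rw [hset ω hω, huniv, mul_div_mul_left _ _ hκ0.ne]

/-- The measure `μ` of a solution is not concentrated on any closed hemisphere. -/
lemma IsSolution.notConcentratedOnHemisphere (hG : ClassCd G) (hΨ : ClassCI Ψ)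
    (hK : K ∈ bodiesAroundOrigin n) (hac : lam ≪ sphericalMeasure n)
    (hopen : ∀ U : Set (Sphere n), IsOpen U → U.Nonempty → 0 < lam U)
    (h : IsSolution G Ψ lam μ K) : NotConcentratedOnHemisphere μ := by
  intro u
  have hnonneg : ∀ v : Sphere n, 0 ≤ max (inner ℝ (u : Space n) (v : Space n)) 0 :=
    fun v => le_max_right _ _
  refine lt_of_le_of_ne (integral_nonneg hnonneg) fun h0 => ?_
  have h1 := (integral_eq_zero_iff_of_nonneg hnonneg
    (integrable_of_continuous (ν := μ) (by fun_prop))).1 h0.symm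
  set ω : Set (Sphere n) := {v | 0 < inner ℝ (u : Space n) (v : Space n)} with hω
  have hωm : MeasurableSet ω := (isOpen_lt continuous_const (by fun_prop)).measurableSet
  have h2 : μ ω = 0 := by
    refine measure_mono_null (fun v hv => ?_) (ae_iff.1 h1)
    exact fun hv' => absurd ((le_max_left _ _).trans_eq hv') (not_le.2 hv)
  have h3 := h.2 ω hωm
  rw [measureReal_def, h2, ENNReal.toReal_zero, zero_div, eq_comm, div_eq_zero_iff,
    or_iff_left h.1, gaussImageMeasure,
    setIntegral_congr_set (reverseRadialGaussImage_ae_eq hK hac ω)] at h3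
  obtain ⟨m, M, hm, hmM⟩ := exists_forall_mem_Icc
    ((continuous_supportFunction K).comp continuous_subtype_val) (supportFunction_pos hK)
  -- A normal v at ξ satisfies v·ξ ≥ h_K(v)/h_K(ξ) ≥ m/h_K(ξ), where m bounds h_K from below on the
  -- sphere. If ξ is closer to u than this, then v·u > 0.
  set U : Set (Sphere n) := {ξ | dist ξ u < invSupport hK ξ * m} with hU
  have hUo : IsOpen U := isOpen_lt (by fun_prop) (by fun_prop)
  have hUn : U.Nonempty := ⟨u, by
    rw [hU, mem_ofPred_eq, dist_self]; exact mul_pos (invSupport_pos hK u) hm⟩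
  have hUsub : ∀ ξ ∈ U, ∀ v ∈ radialGaussImage K ξ, v ∈ ω := by
    intro ξ hξ v hv
    have h4 := (mem_radialGaussImage_iff hK ξ v).1 hv
    have h5 : supportFunction K v * invSupport hK ξ ≤ inner ℝ (v : Space n) (ξ : Space n) := by
      have h6 := apply_le_polarSupport (invSupport hK) ξ
      rwa [h4, invSupport_apply hK v, le_inv_mul_iff₀ (supportFunction_pos hK v)] at h6
    have h6 : inner ℝ (v : Space n) ((ξ : Space n) - u) ≤ dist ξ u := by
      refine (real_inner_le_norm _ _).trans ?_
      rw [norm_eq_of_mem_sphere, one_mul, Subtype.dist_eq, dist_eq_norm]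
    have h7 : invSupport hK ξ * m ≤ supportFunction K v * invSupport hK ξ := by
      rw [mul_comm]
      exact mul_le_mul_of_nonneg_right (hmM v).1 (invSupport_pos hK ξ).le
    have h8 : dist ξ u < invSupport hK ξ * m := hξ
    rw [inner_sub_right] at h6
    rw [hω, mem_ofPred_eq, real_inner_comm]
    linarith
  have hpre : NullMeasurableSet (radialGaussMap K ⁻¹' ω) lam :=
    (aemeasurable_radialGaussMap hK hac).nullMeasurableSet_preimage hωm
  have h4 : ∫ ξ in radialGaussMap K ⁻¹' ω, -gaussImageDensity G Ψ K ξ ∂lam = 0 := by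
    rw [integral_neg, h3, neg_zero]
  rw [integral_eq_zero_iff_of_nonneg
    (fun ξ => (neg_pos.2 (gaussImageDensity_neg hG hΨ hK ξ)).le)
    (integrable_gaussImageDensity hG.toClassC hΨ hK hac).neg.integrableOn] at h4
  have h5 : lam (radialGaussMap K ⁻¹' ω) = 0 := by
    rw [← Measure.restrict_apply_univ]
    refine measure_mono_null (fun ξ _ => ?_) (ae_iff.1 h4)
    exact (neg_pos.2 (gaussImageDensity_neg hG hΨ hK ξ)).ne'
  -- Vanishing image measure of ω forces its preimage to be λ-null, because the density never
  -- vanishes; yet the preimage contains almost all of U.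
  refine (hopen U hUo hUn).ne' ?_
  refine measure_mono_null_ae ?_ h5
  filter_upwards [ae_radialGaussImage_eq hK hac] with ξ hξ hξU
  exact hUsub ξ hξU _ (hξ.1 ▸ mem_singleton _)

end Density

lemma ClassGI.toClassCI {m : ℕ} {H : Sphere m → ℝ → ℝ} (h : ClassGI H) : ClassCI H :=
  ⟨h.toClassC, h.deriv_pos⟩

lemma ClassGd.toClassCd {m : ℕ} {H : Sphere m → ℝ → ℝ} (h : ClassGd H) : ClassCd H :=
  ⟨h.toClassC, h.deriv_neg⟩

lemma exists_isSolution {G Ψ : Sphere n → ℝ → ℝ} {lam μ : Measure (Sphere n)}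
    [IsFiniteMeasure lam] [IsFiniteMeasure μ] (hG : ClassCd G)
    (hGlim : ∀ ξ, Tendsto (G ξ) (𝓝[>] 0) atTop) (hΨ : ClassCI Ψ)
    (hΨlim : ∀ ξ, Tendsto (Ψ ξ) atTop atTop)
    (hpos : (∀ ξ t, 0 < t → 0 < G ξ t) ∨ (∀ ξ t, 0 < t → 0 < Ψ ξ t))
    (hlam : lam ≠ 0) (hac : lam ≪ sphericalMeasure n)
    (hlamH : NotConcentratedOnHemisphere lam) (hμ : μ ≠ 0) (hμH : NotConcentratedOnHemisphere μ) :
    ∃ K ∈ bodiesAroundOrigin n, IsSolution G Ψ lam μ K := by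
  obtain ⟨K, hK, hmin⟩ := exists_minimizer (Γ := fun ξ s => G ξ s⁻¹) hΨ hΨlim hG.inv
    (fun ξ => (hGlim ξ).comp tendsto_inv_atTop_nhdsGT_zero)
    (hpos.imp_left fun h ξ t ht => h ξ _ (inv_pos.2 ht)) hlamH hμH
  exact ⟨K, hK, isSolution_of_integral_eq hG hΨ hK hac hlam
    (integral_eq_of_minimizer hG hΨ hK hac hlam hmin) hμ⟩

end Solution

end MusielakOrlicz

end

theorem mainTheorem1 (n : ℕ) (hn : 2 ≤ n)
    (G Ψ : MusielakOrlicz.Sphere n → ℝ → ℝ)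
    (hGΨ :
      (MusielakOrlicz.ClassCI Ψ ∧ (∀ ξ, Tendsto (Ψ ξ) atTop atTop) ∧
        MusielakOrlicz.ClassGd G) ∨
      (MusielakOrlicz.ClassCd G ∧ (∀ ξ, Tendsto (G ξ) (𝓝[>] 0) atTop) ∧
        MusielakOrlicz.ClassGI Ψ))
    (lam : Measure (MusielakOrlicz.Sphere n)) [IsFiniteMeasure lam] (hlam : lam ≠ 0)
    (hac : lam ≪ MusielakOrlicz.sphericalMeasure n)
    (hlamH : MusielakOrlicz.NotConcentratedOnHemisphere lam)
    (μ : Measure (MusielakOrlicz.Sphere n)) [IsFiniteMeasure μ] (hμ : μ ≠ 0) :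
    (MusielakOrlicz.NotConcentratedOnHemisphere μ →
      ∃ K ∈ MusielakOrlicz.bodiesAroundOrigin n, MusielakOrlicz.IsSolution G Ψ lam μ K) ∧
    ((∀ U : Set (MusielakOrlicz.Sphere n), IsOpen U → U.Nonempty → 0 < lam U) →
      (∃ K ∈ MusielakOrlicz.bodiesAroundOrigin n, MusielakOrlicz.IsSolution G Ψ lam μ K) →
      MusielakOrlicz.NotConcentratedOnHemisphere μ) := by
  have : NeZero n := ⟨by omega⟩
  have : Nonempty (MusielakOrlicz.Sphere n) :=
    (NormedSpace.sphere_nonempty (x := (0 : MusielakOrlicz.Space n))).2 zero_le_one |>.to_subtype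
  have hG : MusielakOrlicz.ClassCd G := hGΨ.elim (fun h => h.2.2.toClassCd) fun h => h.1
  have hΨ : MusielakOrlicz.ClassCI Ψ := hGΨ.elim (fun h => h.1) fun h => h.2.2.toClassCI
  have hGlim : ∀ ξ, Tendsto (G ξ) (𝓝[>] 0) atTop :=
    hGΨ.elim (fun h => h.2.2.tendsto_zero) fun h => h.2.1
  have hΨlim : ∀ ξ, Tendsto (Ψ ξ) atTop atTop :=
    hGΨ.elim (fun h => h.2.1) fun h => h.2.2.tendsto_infty
  -- Beyond the monotonicity and limit conditions common to both cases, the proof needs only the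
  -- positivity of one of the two functions: G in (i), Ψ in (ii).
  have hpos : (∀ ξ t, 0 < t → 0 < G ξ t) ∨ (∀ ξ t, 0 < t → 0 < Ψ ξ t) :=
    hGΨ.imp (fun h => h.2.2.pos) fun h => h.2.2.pos
  refine ⟨fun hμH => MusielakOrlicz.exists_isSolution hG hGlim hΨ hΨlim hpos hlam hac hlamH hμ hμH,
    fun hopen => ?_⟩
  rintro ⟨K, hK, hsol⟩
  exact MusielakOrlicz.IsSolution.notConcentratedOnHemisphere hG hΨ hK hac hopen hsol
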